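/- Let $G=\mathrm{PSL}_2(\mathbb C)$ act on $\mathbb P^1=\mathbb P(\mathbb C^2)$ by Möbius transformations, and let $L^2_{(1,0)}$ be the space of $(1,0)$-forms $\phi$ on $\mathbb P^1$ with $L^2$ coefficients (modulo equality almost everywhere), with the norm $\|\phi\|_{L^2}=\big(\int_{\mathbb P^1} i\,\phi\wedge\overline\phi\big)^{1/2}$. For a Borel probability measure $\mu$ on $G$ and $n\ge 1$, let $\mu^{*n}$ be the $n$-fold convolution power of $\mu$, i.e. the law of $g_n\cdots g_1$ with $g_1,\dots,g_n$ independent of law $\mu$, and let $(f_\mu^n)^*:L^2_{(1,0)}\to L^2_{(1,0)}$ be the bounded linear operator $$(f_\mu^n)^*\phi=\int_G g^*\phi\ \mathrm d\mu^{*n}(g),$$ where the integral converges absolutely at almost every point of $\mathbb P^1$. A subset $R\subset G$ is called elementary if either $R$ is conjugate to a subset of $\mathrm{PSU}(2)$, or there is a non-empty finite subset of $\mathbb P^1$ that is invariant by every element of $R$. The measure $\mu$ is called non-elementary if its support is not elementary. **Proposition.** Let $\mu$ be a non-elementary Borel probability measure on $\mathrm{PSL}_2(\mathbb C)$. Then there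 exists an integer $N\ge 1$ such that the operator norm of $(f_\mu^N)^*:L^2_{(1,0)}\to L^2_{(1,0)}$ is strictly less than $1$. -/

import Mathlib

open MeasureTheory
open scoped MatrixGroups LinearAlgebra.Projectivization ENNReal Matrix

noncomputable section

/-! ### Elementary subsets of `PSL₂(ℂ)` -/

/-- `PSU(2)`, the image of `SU(2)` in `PSL₂(ℂ)`. -/
def PSU2 : Set PSL(2, ℂ) :=
  {g | ∃ A : SL(2, ℂ), (A : Matrix (Fin 2) (Fin 2) ℂ) ∈ Matrix.unitaryGroup (Fin 2) ℂ ∧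
    QuotientGroup.mk A = g}

/-- `R ⊆ PSL₂(ℂ)` is elementary if it is conjugate to a subset of `PSU(2)`, or if some finite
(non-empty) subset of `ℙ¹ = ℙ(ℂ²)` is invariant by every element of `R`. -/
def IsElementary (R : Set PSL(2, ℂ)) : Prop :=
  (∃ h : PSL(2, ℂ), ∀ g ∈ R, h * g * h⁻¹ ∈ PSU2) ∨
  ∃ F : Set (ℙ ℂ (Fin 2 → ℂ)), F.Finite ∧ F.Nonempty ∧ ∀ g ∈ R, (fun p => g • p) '' F = F

/-- The convolution power `μ^{*n} = μ * ⋯ * μ`, i.e. the law of `g_n ⋯ g_1` where the `g_i` are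
independent of law `μ`. -/
def convPow [MeasurableSpace PSL(2, ℂ)] (μ : Measure PSL(2, ℂ)) : ℕ → Measure PSL(2, ℂ)
  | 0 => Measure.dirac 1
  | n + 1 => Measure.mconv μ (convPow μ n)

/-! ### (1,0)-forms on the projective line -/

/-- A (not necessarily continuous) form `φ` of type `(1,0)` on `ℙ¹` is encoded by its pull-back
`Φ = π^*φ` under the projection `π : ℂ² ∖ {0} → ℙ¹`. This identifies the `(1,0)`-forms on `ℙ¹`
with the fields `v ↦ Φ v` of `ℂ`-linear forms on `ℂ² = T_v(ℂ² ∖ {0})` that vanish on the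
tangent direction `ℂ v` of the fibre and are invariant by the dilations of `ℂ²`.
(The invariance forces `Φ 0 = 0`, so that the point `v = 0` carries no information.) -/
def oneFormSubmodule : Submodule ℂ ((Fin 2 → ℂ) → ((Fin 2 → ℂ) →L[ℂ] ℂ)) where
  carrier := {Φ | (∀ v, Φ v v = 0) ∧ ∀ c : ℂ, c ≠ 0 → ∀ v w, Φ (c • v) (c • w) = Φ v w}
  add_mem' := by
    rintro Φ Ψ ⟨h1, h2⟩ ⟨h3, h4⟩
    refine ⟨fun v => by simp [h1, h3], fun c hc v w => ?_⟩
    simp only [Pi.add_apply, add_apply, h2 c hc, h4 c hc]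
  zero_mem' := by simp
  smul_mem' := by
    rintro a Φ ⟨h1, h2⟩
    refine ⟨fun v => by simp [h1], fun c hc v w => ?_⟩
    simp only [Pi.smul_apply, smul_apply, h2 c hc]

/-- The complex vector space of `(1,0)`-forms on `ℙ¹` (see `oneFormSubmodule`). -/
def OneForm : Type := ↥oneFormSubmodule

namespace OneForm

instance : AddCommGroup OneForm := inferInstanceAs (AddCommGroup ↥oneFormSubmodule)

instance : Module ℂ OneForm := inferInstanceAs (Module ℂ ↥oneFormSubmodule)

/-- The linear form `Φ v` on `ℂ² = T_v(ℂ² ∖ {0})`. -/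
def form (Φ : OneForm) (v : Fin 2 → ℂ) : (Fin 2 → ℂ) →L[ℂ] ℂ := Φ.1 v

/-- The coefficient `u` of a form `φ = u dz` in the affine coordinate `z ↦ [z : 1]` of `ℙ¹`:
the value at the point `(z, 1)` on the tangent vector `(1, 0) = d/dz (z, 1)`. -/
def coeff (Φ : OneForm) (z : ℂ) : ℂ := Φ.form ![z, 1] ![1, 0]

/-- The pull-back of a form by a matrix `A ∈ SL₂(ℂ)`, `(A^*Φ)_v (w) = Φ_{A v} (A w)`. -/
def pullbackSL (A : SL(2, ℂ)) (Φ : OneForm) : OneForm :=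
  ⟨fun v => (Φ.form ((A : Matrix (Fin 2) (Fin 2) ℂ) *ᵥ v)).comp
      (LinearMap.toContinuousLinearMap (Matrix.mulVecLin (A : Matrix (Fin 2) (Fin 2) ℂ))), by
    refine ⟨fun v => ?_, fun c hc v w => ?_⟩
    · simpa using! Φ.2.1 ((A : Matrix (Fin 2) (Fin 2) ℂ) *ᵥ v)
    · have h := Φ.2.2 c hc ((A : Matrix (Fin 2) (Fin 2) ℂ) *ᵥ v)
        ((A : Matrix (Fin 2) (Fin 2) ℂ) *ᵥ w)
      rw [← Matrix.mulVec_smul, ← Matrix.mulVec_smul] at h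
      exact h⟩

/-- The pull-back by a matrix only depends on its class in `PSL₂(ℂ)`. -/
theorem pullbackSL_congr (Φ : OneForm) (A B : SL(2, ℂ))
    (h : A⁻¹ * B ∈ Subgroup.center SL(2, ℂ)) : pullbackSL A Φ = pullbackSL B Φ := by
  obtain ⟨r, hr, hC⟩ := Matrix.SpecialLinearGroup.mem_center_iff.1 h
  have hr0 : r ≠ 0 := by
    rintro rfl
    simp at hr
  have hB : (B : Matrix (Fin 2) (Fin 2) ℂ) = r • (A : Matrix (Fin 2) (Fin 2) ℂ) := by
    have h1 : B = A * (A⁻¹ * B) := by group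
    have h2 : (B : Matrix (Fin 2) (Fin 2) ℂ)
        = (A : Matrix (Fin 2) (Fin 2) ℂ) * ((A⁻¹ * B : SL(2, ℂ)) : Matrix (Fin 2) (Fin 2) ℂ) := by
      rw [← Matrix.SpecialLinearGroup.coe_mul, ← h1]
    rw [h2, ← hC, Matrix.scalar_apply, ← Matrix.smul_one_eq_diagonal, Matrix.mul_smul, mul_one]
  refine Subtype.ext (funext fun v => ContinuousLinearMap.ext fun w => ?_)
  have key := Φ.2.2 r hr0 ((A : Matrix (Fin 2) (Fin 2) ℂ) *ᵥ v)
    ((A : Matrix (Fin 2) (Fin 2) ℂ) *ᵥ w)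
  simp only [pullbackSL, form, ContinuousLinearMap.comp_apply,
    LinearMap.coe_toContinuousLinearMap', Matrix.mulVecLin_apply, hB, Matrix.smul_mulVec]
  exact key.symm

/-- The pull-back `g^*φ` of a form by `g ∈ PSL₂(ℂ) = Aut(ℙ¹)`. -/
def pullback (g : PSL(2, ℂ)) (Φ : OneForm) : OneForm :=
  Quotient.liftOn' g (fun A => pullbackSL A Φ) fun A B h =>
    pullbackSL_congr Φ A B (QuotientGroup.leftRel_apply.1 h)

/-- `f_μ^* φ = ∫ g^*φ dμ(g)`, computed pointwise (the value is `0` at the points where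
`g ↦ g^*φ` is not `μ`-integrable). -/
def transfer [MeasurableSpace PSL(2, ℂ)] (μ : Measure PSL(2, ℂ)) (Φ : OneForm) : OneForm :=
  ⟨fun v => ∫ g, (pullback g Φ).form v ∂μ, by
    refine ⟨fun v => ?_, fun c hc v w => ?_⟩
    · by_cases hi : Integrable (fun g => (pullback g Φ).form v) μ
      · rw [ContinuousLinearMap.integral_apply hi]
        have : ∀ g, (pullback g Φ).form v v = 0 := fun g => (pullback g Φ).2.1 v
        simp [this]
      · simp only [integral_undef hi]
        rfl
    · have h : ∀ g, (pullback g Φ).form (c • v) = c⁻¹ • (pullback g Φ).form v := by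
        intro g
        ext1 x
        have h1 : (pullback g Φ).form (c • v) (c • (c⁻¹ • x)) = (pullback g Φ).form v (c⁻¹ • x) :=
          (pullback g Φ).2.2 c hc v (c⁻¹ • x)
        rw [smul_inv_smul₀ hc] at h1
        rw [h1, map_smul, smul_apply]
      simp only [h, integral_smul]
      rw [smul_apply, map_smul, inv_smul_smul₀ hc]⟩

end OneForm

/-! ### The Hilbert space of square integrable (1,0)-forms -/

/-- The measure on `ℂ` given by the area form `i dz ∧ dz̄ = 2 dx ∧ dy`. -/
def areaMeasure : Measure ℂ := (2 : ℝ≥0∞) • volume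

/-- `φ` has `L²` coefficients. If `φ = u dz` in the affine coordinate `z`, which misses only one
point of `ℙ¹`, then `∫_{ℙ¹} i φ ∧ φ̄ = ∫_ℂ |u|² i dz ∧ dz̄`. -/
def OneForm.MemL2 (Φ : OneForm) : Prop := MemLp Φ.coeff 2 areaMeasure

/-- The space of `(1,0)`-forms with `L²` coefficients, before identifying forms that agree almost
everywhere. -/
def l2FormSubmodule : Submodule ℂ OneForm where
  carrier := {Φ | Φ.MemL2}
  add_mem' := fun h1 h2 => MemLp.add h1 h2
  zero_mem' := MemLp.zero' (μ := areaMeasure) (p := 2) (ε := ℂ)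
  smul_mem' := fun a _ h => MemLp.const_smul h a

/-- See `l2FormSubmodule`. -/
def PreL2Form : Type := ↥l2FormSubmodule

namespace PreL2Form

instance : AddCommGroup PreL2Form := inferInstanceAs (AddCommGroup ↥l2FormSubmodule)

instance : Module ℂ PreL2Form := inferInstanceAs (Module ℂ ↥l2FormSubmodule)

/-- The linear map sending `φ = u dz` to the class of `u` in `L²(ℂ, i dz ∧ dz̄)`. -/
def coeffLp : PreL2Form →ₗ[ℂ] Lp ℂ 2 areaMeasure where
  toFun Φ := MemLp.toLp (OneForm.coeff Φ.1) Φ.2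
  map_add' Φ Ψ := MemLp.toLp_add Φ.2 Ψ.2
  map_smul' a Φ := MemLp.toLp_const_smul a Φ.2

/-- The seminorm `‖φ‖ = (∫_{ℙ¹} i φ ∧ φ̄)^{1/2}`. -/
instance : SeminormedAddCommGroup PreL2Form :=
  SeminormedAddCommGroup.induced PreL2Form (Lp ℂ 2 areaMeasure) coeffLp

instance : NormedSpace ℂ PreL2Form := NormedSpace.induced ℂ PreL2Form (Lp ℂ 2 areaMeasure) coeffLp

end PreL2Form

/-- The normed space `L²_{(1,0)}` of `(1,0)`-forms on `ℙ¹` with `L²` coefficients, modulo equality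
almost everywhere, with the norm `‖φ‖ = (∫_{ℙ¹} i φ ∧ φ̄)^{1/2}`. -/
abbrev L2Form : Type := SeparationQuotient PreL2Form

/-- The class in `L²_{(1,0)}` of a form with `L²` coefficients. -/
def L2Form.mk (Φ : OneForm) (h : Φ.MemL2) : L2Form :=
  SeparationQuotient.mk (⟨Φ, h⟩ : PreL2Form)

/-- `T` is the operator `f_μ^* : L²_{(1,0)} → L²_{(1,0)}`: for every form `φ` with `L²`
coefficients, the integral `∫ g^*φ dμ(g)` converges absolutely at almost every point of `ℙ¹`, and
it defines a form with `L²` coefficients whose class is the image by `T` of the class of `φ`. -/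
def IsTransferOperator [MeasurableSpace PSL(2, ℂ)] (μ : Measure PSL(2, ℂ))
    (T : L2Form →L[ℂ] L2Form) : Prop :=
  ∀ (Φ : OneForm) (hΦ : Φ.MemL2),
    (∀ᵐ z : ℂ, Integrable (fun g => (Φ.pullback g).form ![z, 1]) μ) ∧
    ∃ h : (Φ.transfer μ).MemL2, T (L2Form.mk Φ hΦ) = L2Form.mk (Φ.transfer μ) h

end

/-! Pull-back by a homography is an isometry of L² forms, since the Jacobian of the homography is
the square of the modulus of its derivative. The transfer operator averages isometries, so the loss
of norm is a variance: ∫ ‖g^*φ - f_μ^*φ‖² dμ(g) + ‖f_μ^*φ‖² = ‖φ‖²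
(`OneForm.lintegral_defect_add_energy`).

If no power of the operator had norm less than 1, there would be unit forms φ_n whose first n + 1
iterates lose at most 2^(-n) of their energy. With φ_{n,N} the N-th iterate of φ_n, the defects
‖g^*φ_{n,N} - φ_{n,N+1}‖² have summable integrals in n, hence tend to 0 for every N and all g in a
set S of full measure (`isElementary_support`). An ultralimit in n of the densities |φ_{n,N}|² gives
finitely additive probabilities m_N on ℙ¹ with g_* m_{N+1} = m_N for g in S
(`isElementary_of_almost_invariant`).

Let H be the group preserving every m_N. It contains g h⁻¹ for g, h in S, and g H g⁻¹ ⊆ H for g in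
S. If H is unbounded, its large elements contract almost all of ℙ¹ towards one point, which forces
m_0 to have a point of mass at least 1/2 (`exists_contraction`). There are at most two such points,
and S sends those of m_1 to those of m_0, which yields a finite S-invariant set or a fixed point of
H (`isElementary_of_invariant_sets`). If H is bounded, it preserves a Hermitian form; either S
preserves it too, or a second H-invariant form provides a fixed point of H
(`isElementary_of_bounded`). A fixed point of H always makes S elementary (`isElementary_of_fixed`).
Elementarity is a closed condition, so it passes from S to the support of μ
(`IsElementary.of_subset_closure`). -/

noncomputable section

/-! ### Points of the projective line -/

/-- The determinant of two vectors of the plane. -/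
def wedge (v w : Fin 2 → ℂ) : ℂ := v 0 * w 1 - v 1 * w 0

theorem exists_smul_eq_of_wedge_eq_zero {v w : Fin 2 → ℂ} (hw : w ≠ 0) (h : wedge v w = 0) :
    ∃ c : ℂ, v = c • w := by
  unfold wedge at h
  by_cases h0 : w 0 = 0
  · have h1 : w 1 ≠ 0 := fun h1 => hw (by ext i; fin_cases i <;> simp [h0, h1])
    refine ⟨v 1 / w 1, ?_⟩
    ext i
    fin_cases i
    · simp [h0] at h ⊢
      tauto
    · simp [h1]
  · refine ⟨v 0 / w 0, ?_⟩
    ext i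
    fin_cases i
    · simp [h0]
    · simp
      field_simp
      linear_combination -h

theorem Projectivization.mk_eq_mk_iff_wedge {v w : Fin 2 → ℂ} (hv : v ≠ 0) (hw : w ≠ 0) :
    Projectivization.mk ℂ v hv = Projectivization.mk ℂ w hw ↔ wedge v w = 0 := by
  rw [Projectivization.mk_eq_mk_iff']
  constructor
  · rintro ⟨a, rfl⟩
    simp [wedge]
    ring
  · intro h
    obtain ⟨c, hc⟩ := exists_smul_eq_of_wedge_eq_zero hw h
    exact ⟨c, hc.symm⟩

theorem SL_mulVec_ne_zero (A : SL(2, ℂ)) {v : Fin 2 → ℂ} (hv : v ≠ 0) :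
    (A : Matrix (Fin 2) (Fin 2) ℂ) *ᵥ v ≠ 0 := by
  intro h
  apply hv
  have : (((A⁻¹ : SL(2, ℂ)) : Matrix (Fin 2) (Fin 2) ℂ) * (A : Matrix (Fin 2) (Fin 2) ℂ)) *ᵥ v = 0 := by
    rw [← Matrix.mulVec_mulVec, h, Matrix.mulVec_zero]
  rwa [← Matrix.SpecialLinearGroup.coe_mul, inv_mul_cancel, Matrix.SpecialLinearGroup.coe_one,
    Matrix.one_mulVec] at this

theorem PSL_smul_mk (A : SL(2, ℂ)) {v : Fin 2 → ℂ} (hv : v ≠ 0) :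
    (QuotientGroup.mk A : PSL(2, ℂ)) • Projectivization.mk ℂ v hv =
      Projectivization.mk ℂ ((A : Matrix (Fin 2) (Fin 2) ℂ) *ᵥ v) (SL_mulVec_ne_zero A hv) := rfl

theorem PSL_smul_eq_mk_iff (A : SL(2, ℂ)) {v w : Fin 2 → ℂ} (hv : v ≠ 0) (hw : w ≠ 0) :
    (QuotientGroup.mk A : PSL(2, ℂ)) • Projectivization.mk ℂ v hv = Projectivization.mk ℂ w hw ↔
      wedge ((A : Matrix (Fin 2) (Fin 2) ℂ) *ᵥ v) w = 0 := by
  rw [PSL_smul_mk, Projectivization.mk_eq_mk_iff_wedge]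

/-- A line through `y` is fixed exactly when the binary quadratic form `wedge (A y) y` vanishes, and
such a form with three distinct zeros on ℙ¹ is zero. The identity `h3` is Lagrange interpolation at
the three zeros. -/
theorem PSL_eq_one_of_three_fixed (g : PSL(2, ℂ)) (p q r : ℙ ℂ (Fin 2 → ℂ)) (hpq : p ≠ q)
    (hpr : p ≠ r) (hqr : q ≠ r) (hp : g • p = p) (hq : g • q = q) (hr : g • r = r) : g = 1 := by
  induction g using QuotientGroup.induction_on with | H A
  induction p using Projectivization.ind with | h v hv
  induction q using Projectivization.ind with | h w hw
  induction r using Projectivization.ind with | h x hx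
  rw [PSL_smul_eq_mk_iff] at hp hq hr
  rw [Ne, Projectivization.mk_eq_mk_iff_wedge] at hpq hpr hqr
  have key : ∀ y, wedge ((A : Matrix (Fin 2) (Fin 2) ℂ) *ᵥ y) y = 0 := by
    intro y
    have h3 : wedge v w * (wedge v x) * (wedge w x) * wedge ((A : Matrix (Fin 2) (Fin 2) ℂ) *ᵥ y) y = 0 := by
      simp only [wedge, Matrix.mulVec, dotProduct, Fin.sum_univ_two] at *
      generalize v 0 = v0 at *
      generalize v 1 = v1 at *
      generalize w 0 = w0 at *
      generalize w 1 = w1 at *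
      generalize x 0 = x0 at *
      generalize x 1 = x1 at *
      generalize y 0 = y0 at *
      generalize y 1 = y1 at *
      linear_combination (w0*x1-w1*x0)*(w0*y1-w1*y0)*(x0*y1-x1*y0)*hp - (v0*x1-v1*x0)*(v0*y1-v1*y0)*(x0*y1-x1*y0)*hq + (v0*w1-v1*w0)*(v0*y1-v1*y0)*(w0*y1-w1*y0)*hr
    simpa [hpq, hpr, hqr] using h3
  apply eq_of_smul_eq_smul (α := ℙ ℂ (Fin 2 → ℂ))
  intro p
  induction p using Projectivization.ind with | h y hy
  rw [one_smul, PSL_smul_eq_mk_iff]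
  exact key y

theorem PSL_exists_fixed (g : PSL(2, ℂ)) : ∃ p : ℙ ℂ (Fin 2 → ℂ), g • p = p := by
  induction g using QuotientGroup.induction_on with | H A
  obtain ⟨c, hc⟩ := Module.End.exists_eigenvalue (Matrix.toLin' (A : Matrix (Fin 2) (Fin 2) ℂ))
  obtain ⟨v, hv⟩ := hc.exists_hasEigenvector
  have h1 := hv.apply_eq_smul
  rw [Matrix.toLin'_apply] at h1
  refine ⟨Projectivization.mk ℂ v hv.2, ?_⟩
  rw [PSL_smul_eq_mk_iff, h1]
  simp [wedge]
  ring

/-! ### Elementary sets -/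

theorem IsElementary.of_finite {S : Set PSL(2, ℂ)} (F : Set (ℙ ℂ (Fin 2 → ℂ))) (hF : F.Finite)
    (hne : F.Nonempty) (h : ∀ g ∈ S, ∀ p ∈ F, g • p ∈ F) : IsElementary S := by
  refine Or.inr ⟨F, hF, hne, fun g hg => ?_⟩
  exact (Set.Finite.surjOn_iff_bijOn_of_mapsTo hF (h g hg)).1
    ((hF.injOn_iff_bijOn_of_mapsTo (h g hg)).1 ((MulAction.injective g).injOn)).surjOn |>.image_eq

/-- The common fixed points of `H` are permuted by `S`. The hypothesis on conjugation is one-sided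
and only gives stability under g⁻¹; finiteness of the fixed set upgrades it to stability under g. If
there are three fixed points, `H` is trivial, `S` has at most one element, and that element fixes a
point. -/
theorem isElementary_of_fixed {S : Set PSL(2, ℂ)} {H : Subgroup PSL(2, ℂ)}
    (hS : ∀ g ∈ S, ∀ h ∈ S, g * h⁻¹ ∈ H) (hc : ∀ g ∈ S, ∀ h ∈ H, g * h * g⁻¹ ∈ H)
    (p : ℙ ℂ (Fin 2 → ℂ)) (hp : ∀ h ∈ H, h • p = p) : IsElementary S := by
  set E : Set (ℙ ℂ (Fin 2 → ℂ)) := {q | ∀ h ∈ H, h • q = q} with hE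
  by_cases hfin : E.Finite
  · have hinv : ∀ g ∈ S, Set.MapsTo (fun q => g⁻¹ • q) E E := by
      intro g hg q hq h hh
      have := hq _ (hc g hg h hh)
      show h • g⁻¹ • q = g⁻¹ • q
      rw [eq_inv_smul_iff]
      simpa [mul_smul] using this
    refine IsElementary.of_finite E hfin ⟨p, hp⟩ fun g hg q hq => ?_
    obtain ⟨r, hr, hrq⟩ := ((hfin.injOn_iff_bijOn_of_mapsTo (hinv g hg)).1
      (MulAction.injective g⁻¹).injOn).surjOn hq
    have : g • q = r := by rw [← hrq]; simp
    rwa [this]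
  · classical
    obtain ⟨t, ht, hcard⟩ := Set.Infinite.exists_subset_card_eq hfin 3
    obtain ⟨a, b, c, hab, hac, hbc, rfl⟩ := Finset.card_eq_three.1 hcard
    have ha : a ∈ E := ht (by simp)
    have hb : b ∈ E := ht (by simp)
    have hcc : c ∈ E := ht (by simp)
    have h1 : ∀ h ∈ H, h = 1 := fun h hh =>
      PSL_eq_one_of_three_fixed h a b c hab hac hbc (ha h hh) (hb h hh) (hcc h hh)
    rcases S.eq_empty_or_nonempty with rfl | ⟨g, hg⟩
    · exact Or.inl ⟨1, by simp⟩
    · obtain ⟨q, hq⟩ := PSL_exists_fixed g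
      refine IsElementary.of_finite {q} (Set.finite_singleton q) ⟨q, rfl⟩ ?_
      rintro h hh _ rfl
      have := mul_inv_eq_one.1 (h1 _ (hS h hh g hg))
      rw [this, hq]
      rfl

/-! ### Elementarity passes to the closure -/

theorem PSL_isClosed_iff {s : Set PSL(2, ℂ)} :
    IsClosed s ↔ IsClosed ((QuotientGroup.mk : SL(2, ℂ) → PSL(2, ℂ)) ⁻¹' s) :=
  ((QuotientGroup.isQuotientMap_mk _).isClosed_preimage).symm

theorem SL_continuous_coe : Continuous fun A : SL(2, ℂ) => (A : Matrix (Fin 2) (Fin 2) ℂ) :=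
  continuous_subtype_val

/-- Two lifts differ by a central scalar of modulus one, so unitarity does not depend on the lift.
-/
theorem mk_mem_PSU2_iff (A : SL(2, ℂ)) : (QuotientGroup.mk A : PSL(2, ℂ)) ∈ PSU2 ↔
    (A : Matrix (Fin 2) (Fin 2) ℂ) ∈ Matrix.unitaryGroup (Fin 2) ℂ := by
  refine ⟨?_, fun h => ⟨A, h, rfl⟩⟩
  rintro ⟨B, hB, hBA⟩
  rw [QuotientGroup.eq] at hBA
  obtain ⟨r, hr, hC⟩ := Matrix.SpecialLinearGroup.mem_center_iff.1 hBA
  have h2 : (A : Matrix (Fin 2) (Fin 2) ℂ)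
      = (B : Matrix (Fin 2) (Fin 2) ℂ) * ((B⁻¹ * A : SL(2, ℂ)) : Matrix (Fin 2) (Fin 2) ℂ) := by
    rw [← Matrix.SpecialLinearGroup.coe_mul]
    rw [mul_inv_cancel_left]
  rw [h2, ← hC]
  refine mul_mem hB ?_
  have hr2 : ‖r‖ = 1 := by
    have := congrArg norm hr
    simp only [Fintype.card_fin, norm_pow, norm_one] at this
    exact (pow_eq_one_iff_of_nonneg (norm_nonneg r) two_ne_zero).1 this
  rw [Matrix.mem_unitaryGroup_iff, Matrix.star_eq_conjTranspose, Matrix.scalar_apply,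
    Matrix.diagonal_conjTranspose, Matrix.diagonal_mul_diagonal, ← Matrix.diagonal_one]
  congr 1
  ext i
  simp [Complex.mul_conj, Complex.normSq_eq_norm_sq, hr2]

theorem isClosed_PSU2 : IsClosed PSU2 := by
  rw [PSL_isClosed_iff]
  have : (QuotientGroup.mk : SL(2, ℂ) → PSL(2, ℂ)) ⁻¹' PSU2 =
      {A : SL(2, ℂ) | (A : Matrix (Fin 2) (Fin 2) ℂ) * (A : Matrix (Fin 2) (Fin 2) ℂ)ᴴ = 1} := by
    ext A
    rw [Set.mem_preimage, mk_mem_PSU2_iff, Matrix.mem_unitaryGroup_iff]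
    rfl
  rw [this]
  exact isClosed_eq (SL_continuous_coe.mul SL_continuous_coe.matrix_conjTranspose)
    continuous_const

theorem isClosed_setOf_smul_eq (p q : ℙ ℂ (Fin 2 → ℂ)) :
    IsClosed {g : PSL(2, ℂ) | g • p = q} := by
  induction p using Projectivization.ind with | h v hv
  induction q using Projectivization.ind with | h w hw
  rw [PSL_isClosed_iff]
  simp only [Set.preimage_ofPred_eq, PSL_smul_eq_mk_iff]
  refine isClosed_eq ?_ continuous_const
  have h := SL_continuous_coe.matrix_mulVec (continuous_const (y := v))
  unfold wedge
  exact (((continuous_apply 0).comp h).mul_const _).sub (((continuous_apply 1).comp h).mul_const _)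

theorem IsElementary.of_subset_closure {S T : Set PSL(2, ℂ)} (hS : IsElementary S)
    (hT : T ⊆ closure S) : IsElementary T := by
  rcases hS with ⟨h, hh⟩ | ⟨F, hF, hne, hinv⟩
  · refine Or.inl ⟨h, fun g hg => ?_⟩
    have hcl : IsClosed {g : PSL(2, ℂ) | h * g * h⁻¹ ∈ PSU2} :=
      isClosed_PSU2.preimage (by fun_prop)
    exact closure_minimal hh hcl (hT hg)
  · refine IsElementary.of_finite F hF hne fun g hg p hp => ?_
    have hcl : IsClosed {g : PSL(2, ℂ) | g • p ∈ F} := by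
      have : {g : PSL(2, ℂ) | g • p ∈ F} = ⋃ q ∈ F, {g | g • p = q} := by
        ext g; simp
      rw [this]
      exact hF.isClosed_biUnion fun q _ => isClosed_setOf_smul_eq p q
    refine closure_minimal (fun g hg => ?_) hcl (hT hg)
    exact (hinv g hg).le ⟨p, hp, rfl⟩

/-! ### Bounded subgroups -/

theorem PSL_exists_smul_of_mk_eq {A B : SL(2, ℂ)}
    (h : (QuotientGroup.mk A : PSL(2, ℂ)) = QuotientGroup.mk B) :
    ∃ r : ℂ, ‖r‖ = 1 ∧
      (B : Matrix (Fin 2) (Fin 2) ℂ) = r • (A : Matrix (Fin 2) (Fin 2) ℂ) := by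
  rw [QuotientGroup.eq] at h
  obtain ⟨r, hr, hC⟩ := Matrix.SpecialLinearGroup.mem_center_iff.1 h
  refine ⟨r, ?_, ?_⟩
  · have := congrArg norm hr
    simp only [Fintype.card_fin, norm_pow, norm_one] at this
    exact (pow_eq_one_iff_of_nonneg (norm_nonneg r) two_ne_zero).1 this
  · have h2 : (B : Matrix (Fin 2) (Fin 2) ℂ)
        = (A : Matrix (Fin 2) (Fin 2) ℂ) * ((A⁻¹ * B : SL(2, ℂ)) : Matrix (Fin 2) (Fin 2) ℂ) := by
      rw [← Matrix.SpecialLinearGroup.coe_mul, mul_inv_cancel_left]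
    rw [h2, ← hC, Matrix.scalar_apply, ← Matrix.smul_one_eq_diagonal, Matrix.mul_smul, mul_one]

/-- This is a form of strict concavity for the determinant on positive definite matrices. It makes
the maximiser of the determinant on a convex set unique. -/
theorem Matrix.IsHermitian.eq_of_det_midpoint_le {X Y : Matrix (Fin 2) (Fin 2) ℂ}
    (hX : X.IsHermitian) (hY : Y.IsHermitian) (hX0 : 0 < (X 0 0).re) (hY0 : 0 < (Y 0 0).re)
    (hXpos : 0 < X.det.re) (hXY : X.det.re = Y.det.re)
    (hle : (((1 / 2 : ℝ) • X + (1 / 2 : ℝ) • Y).det).re ≤ X.det.re) : X = Y := by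
  have eX00 := hX.apply 0 0
  have eX11 := hX.apply 1 1
  have eX10 := hX.apply 1 0
  have eY00 := hY.apply 0 0
  have eY11 := hY.apply 1 1
  have eY10 := hY.apply 1 0
  simp only [Matrix.det_fin_two, Matrix.add_apply, Matrix.smul_apply] at hXpos hXY hle
  simp only [Complex.ext_iff, Complex.star_def, Complex.conj_re, Complex.conj_im,
    Complex.sub_re, Complex.mul_re, Complex.mul_im, Complex.add_re, Complex.add_im,
    Complex.real_smul, Complex.ofReal_re, Complex.ofReal_im] at *
  have ex : X = !![X 0 0, X 0 1; X 1 0, X 1 1] := Matrix.eta_fin_two X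
  have ey : Y = !![Y 0 0, Y 0 1; Y 1 0, Y 1 1] := Matrix.eta_fin_two Y
  generalize hx1 : X 0 0 = x1 at *
  generalize hx2 : X 0 1 = x2 at *
  generalize hx3 : X 1 0 = x3 at *
  generalize hx4 : X 1 1 = x4 at *
  generalize hy1 : Y 0 0 = y1 at *
  generalize hy2 : Y 0 1 = y2 at *
  generalize hy3 : Y 1 0 = y3 at *
  generalize hy4 : Y 1 1 = y4 at *
  obtain ⟨a, a'⟩ := x1
  obtain ⟨b, b'⟩ := x2
  obtain ⟨c, c'⟩ := x3
  obtain ⟨d, d'⟩ := x4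
  obtain ⟨e, e'⟩ := y1
  obtain ⟨f, f'⟩ := y2
  obtain ⟨g, g'⟩ := y3
  obtain ⟨h, h'⟩ := y4
  simp only at *
  obtain rfl : a' = 0 := by linarith
  obtain rfl : d' = 0 := by linarith
  obtain rfl : e' = 0 := by linarith
  obtain rfl : h' = 0 := by linarith
  obtain ⟨rfl, h1⟩ := eX10
  obtain rfl : c' = -b' := by linarith
  obtain ⟨rfl, h2⟩ := eY10
  obtain rfl : g' = -f' := by linarith
  clear h1 h2 eX00 eX11 eY00 eY11
  have hle2 : a * h + e * d - 2 * (b * f + b' * f') ≤ 2 * (a * d - (b * b + b' * b')) := by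
    nlinarith
  set D := a * d - (b * b + b' * b') with hD
  have hDX : a * d = D + b * b + b' * b' := by rw [hD]; ring
  have hDY : e * h = D + f * f + f' * f' := by linarith
  have hDpos : 0 < D := by rw [hD]; linarith
  -- Multiplying `hle2` by the positive number a e and eliminating d and h through the two
  -- determinants leaves a sum of squares.
  have key : D * (a - e) ^ 2 + (a * f - e * b) ^ 2 + (a * f' - e * b') ^ 2 ≤ 0 := by
    have := mul_le_mul_of_nonneg_left hle2 (mul_pos hX0 hY0).le
    linear_combination this - a ^ 2 * hDY - e ^ 2 * hDX
  have k1 : D * (a - e) ^ 2 = 0 := by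
    refine le_antisymm ?_ (by positivity)
    nlinarith [sq_nonneg (a * f - e * b), sq_nonneg (a * f' - e * b')]
  have k2 : a = e := by
    have := (mul_eq_zero.1 k1).resolve_left hDpos.ne'
    nlinarith [pow_eq_zero_iff (two_ne_zero) |>.1 this]
  subst k2
  have k3 : a * f - a * b = 0 := by
    refine pow_eq_zero_iff (two_ne_zero) |>.1 (le_antisymm ?_ (sq_nonneg _))
    nlinarith [sq_nonneg (a * f' - a * b')]
  have k4 : a * f' - a * b' = 0 := by
    refine pow_eq_zero_iff (two_ne_zero) |>.1 (le_antisymm ?_ (sq_nonneg _))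
    nlinarith [sq_nonneg (a * f - a * b)]
  have k5 : f = b := mul_left_cancel₀ hX0.ne' (by linarith)
  have k6 : f' = b' := mul_left_cancel₀ hX0.ne' (by linarith)
  subst k5 k6
  have k7 : d = h := mul_left_cancel₀ hX0.ne' (by linarith)
  subst k7
  rw [ex, ey]

/-- A closed convex cone of Hermitian matrices that contains the positive semidefinite ones. -/
def hermitianCone : Set (Matrix (Fin 2) (Fin 2) ℂ) :=
  {X | Xᴴ = X ∧ 0 ≤ (X 0 0).re}

theorem isClosed_hermitianCone : IsClosed hermitianCone := by
  refine IsClosed.and (isClosed_eq continuous_id.matrix_conjTranspose continuous_id)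
    (isClosed_le continuous_const ?_)
  exact Complex.continuous_re.comp (continuous_id.matrix_elem 0 0)

theorem convex_hermitianCone : Convex ℝ hermitianCone := by
  rintro X ⟨hX, hX0⟩ Y ⟨hY, hY0⟩ a b ha hb hab
  refine ⟨?_, ?_⟩
  · rw [Matrix.conjTranspose_add, Matrix.conjTranspose_smul, Matrix.conjTranspose_smul, hX, hY]
    simp
  · simp only [Matrix.add_apply, Matrix.smul_apply, Complex.add_re, Complex.real_smul,
      Complex.re_ofReal_mul]
    positivity

attribute [local instance] Matrix.normedAddCommGroup Matrix.normedSpace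

/-- A bounded subgroup of `SL₂(ℂ)` preserves a positive definite Hermitian form. -/
theorem exists_invariant_hermitian (K : Subgroup SL(2, ℂ)) (C : ℝ)
    (hC : ∀ A ∈ K, ∀ i j, ‖(A : Matrix (Fin 2) (Fin 2) ℂ) i j‖ ≤ C) :
    ∃ P : Matrix (Fin 2) (Fin 2) ℂ, P.IsHermitian ∧ 0 < (P 0 0).re ∧ 0 < P.det.re ∧
      ∀ A ∈ K, (A : Matrix (Fin 2) (Fin 2) ℂ)ᴴ * P * (A : Matrix (Fin 2) (Fin 2) ℂ) = P := by
  set Q : Set (Matrix (Fin 2) (Fin 2) ℂ) :=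
    (fun A : SL(2, ℂ) => (A : Matrix (Fin 2) (Fin 2) ℂ)ᴴ * (A : Matrix (Fin 2) (Fin 2) ℂ)) '' K
  set T := closure (convexHull ℝ Q) with hT
  have hQT : Q ⊆ T := (subset_convexHull ℝ Q).trans subset_closure
  have hTconv : Convex ℝ T := (convex_convexHull ℝ Q).closure
  have hmin : ∀ U : Set (Matrix (Fin 2) (Fin 2) ℂ), IsClosed U → Convex ℝ U → Q ⊆ U → T ⊆ U :=
    fun U h1 h2 h3 => closure_minimal (convexHull_min h3 h2) h1
  have hQb : Bornology.IsBounded Q := by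
    have hcomp : IsCompact ({X | ∀ i j, ‖X i j‖ ≤ C} : Set (Matrix (Fin 2) (Fin 2) ℂ)) := by
      have : ({X | ∀ i j, ‖X i j‖ ≤ C} : Set (Matrix (Fin 2) (Fin 2) ℂ)) =
          Set.pi Set.univ fun _ => Set.pi Set.univ fun _ => Metric.closedBall (0 : ℂ) C := by
        ext X
        exact ⟨fun h i _ j _ => by simpa using h i j,
          fun h i j => by simpa using h i trivial j trivial⟩
      rw [this]
      exact isCompact_univ_pi fun _ => isCompact_univ_pi fun _ => isCompact_closedBall _ _
    have him := hcomp.image (f := fun X : Matrix (Fin 2) (Fin 2) ℂ => Xᴴ * X)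
      (continuous_id.matrix_conjTranspose.mul continuous_id)
    refine him.isBounded.subset ?_
    rintro _ ⟨A, hA, rfl⟩
    exact ⟨A, hC A hA, rfl⟩
  have hTc : IsCompact T :=
    Metric.isCompact_of_isClosed_isBounded isClosed_closure
      ((isBounded_convexHull.2 hQb).closure)
  have hpsd : T ⊆ hermitianCone := by
    refine hmin _ isClosed_hermitianCone convex_hermitianCone ?_
    rintro _ ⟨A, hA, rfl⟩
    refine ⟨by simp [Matrix.conjTranspose_mul], ?_⟩
    simp only [Matrix.mul_apply, Fin.sum_univ_two, Matrix.conjTranspose_apply, Complex.star_def,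
      Complex.add_re, ← Complex.normSq_eq_conj_mul_self, Complex.ofReal_re]
    exact add_nonneg (Complex.normSq_nonneg _) (Complex.normSq_nonneg _)
  have h1T : (1 : Matrix (Fin 2) (Fin 2) ℂ) ∈ T :=
    hQT ⟨1, K.one_mem, by simp⟩
  have hdc : Continuous fun X : Matrix (Fin 2) (Fin 2) ℂ => X.det.re :=
    Complex.continuous_re.comp continuous_id.matrix_det
  -- `P` maximises the determinant on the closed convex hull of the orbit of the standard form. Each
  -- X ↦ Aᴴ X A with `A` in the group preserves this hull and the determinant, so uniqueness of the
  -- maximiser makes `P` invariant.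
  obtain ⟨P, hPT, hP⟩ := hTc.exists_isMaxOn ⟨1, h1T⟩ hdc.continuousOn
  have hPdet : 0 < P.det.re := by
    have := hP h1T
    simp only [Matrix.det_one, Complex.one_re, Set.mem_ofPred_eq] at this
    linarith
  have hpos : ∀ X ∈ T, 0 < X.det.re → 0 < (X 0 0).re := by
    intro X hX hd
    obtain ⟨h1, h2⟩ := hpsd hX
    refine lt_of_le_of_ne h2 fun h0 => ?_
    have e10 : star (X 0 1) = X 1 0 := Matrix.IsHermitian.apply h1 1 0
    rw [Matrix.det_fin_two, ← e10, Complex.star_def, Complex.mul_conj, Complex.sub_re,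
      Complex.mul_re, ← h0, Complex.ofReal_re] at hd
    have e00 : star (X 0 0) = X 0 0 := Matrix.IsHermitian.apply h1 0 0
    have : (X 0 0).im = 0 := by
      have := congrArg Complex.im e00
      simp at this
      linarith
    rw [this] at hd
    have := Complex.normSq_nonneg (X 0 1)
    linarith
  refine ⟨P, (hpsd hPT).1, hpos P hPT hPdet, hPdet, fun A hA => ?_⟩
  set Y := (A : Matrix (Fin 2) (Fin 2) ℂ)ᴴ * P * (A : Matrix (Fin 2) (Fin 2) ℂ) with hY
  have hYT : Y ∈ T := by
    have hsub : T ⊆ (fun X => (A : Matrix (Fin 2) (Fin 2) ℂ)ᴴ * X *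
        (A : Matrix (Fin 2) (Fin 2) ℂ)) ⁻¹' T := by
      refine hmin _ (isClosed_closure.preimage (by fun_prop)) ?_ ?_
      · intro X hX Z hZ a b ha hb hab
        have := hTconv hX hZ ha hb hab
        simpa [Matrix.mul_add, Matrix.add_mul] using this
      · rintro _ ⟨B, hB, rfl⟩
        refine hQT ⟨B * A, K.mul_mem hB hA, ?_⟩
        simp [Matrix.conjTranspose_mul, Matrix.mul_assoc]
    exact hsub hPT
  have hYdet : Y.det = P.det := by
    rw [hY, Matrix.det_mul, Matrix.det_mul, Matrix.det_conjTranspose]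
    simp
  symm
  refine Matrix.IsHermitian.eq_of_det_midpoint_le (hpsd hPT).1 (hpsd hYT).1 (hpos P hPT hPdet)
    (hpos Y hYT (by rwa [hYdet])) hPdet (by rw [hYdet]) ?_
  exact hP (hTconv hPT hYT (by norm_num) (by norm_num) (by norm_num))

/-- A bounded subgroup of `SL₂(ℂ)` is conjugate to a subgroup of `SU(2)`. -/
theorem exists_conj_unitary (K : Subgroup SL(2, ℂ)) (C : ℝ)
    (hC : ∀ A ∈ K, ∀ i j, ‖(A : Matrix (Fin 2) (Fin 2) ℂ) i j‖ ≤ C) :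
    ∃ h : SL(2, ℂ), ∀ A ∈ K, ((h * A * h⁻¹ : SL(2, ℂ)) : Matrix (Fin 2) (Fin 2) ℂ) ∈
      Matrix.unitaryGroup (Fin 2) ℂ := by
  obtain ⟨P, hP, hP0, hPd, hinv⟩ := exists_invariant_hermitian K C hC
  obtain ⟨h, s, hs, hh⟩ : ∃ (h : SL(2, ℂ)) (s : ℂ), s ≠ 0 ∧
      (h : Matrix (Fin 2) (Fin 2) ℂ)ᴴ * (h : Matrix (Fin 2) (Fin 2) ℂ) = s • P := by
    set a := (P 0 0).re with ha
    set D := P.det.re with hD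
    set t := Real.sqrt D with ht
    have htpos : 0 < t := Real.sqrt_pos.2 hPd
    have htD : t * t = D := Real.mul_self_sqrt hPd.le
    set x := Real.sqrt (a / t) with hx
    have hxpos : 0 < x := Real.sqrt_pos.2 (div_pos hP0 htpos)
    have hxx : x * x = a / t := Real.mul_self_sqrt (div_pos hP0 htpos).le
    have e00 : P 0 0 = (a : ℂ) := by
      have := hP.apply 0 0
      apply Complex.ext
      · simp [ha]
      · have := congrArg Complex.im this
        simp at this ⊢
        linarith
    have e11 : P 1 1 = ((P 1 1).re : ℂ) := by
      have := hP.apply 1 1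
      apply Complex.ext
      · simp
      · have := congrArg Complex.im this
        simp at this ⊢
        linarith
    have e10 : P 1 0 = (starRingEnd ℂ) (P 0 1) := (hP.apply 1 0).symm
    have hDe : D = a * (P 1 1).re - Complex.normSq (P 0 1) := by
      rw [hD, Matrix.det_fin_two, e00, e11, e10, Complex.mul_conj]
      simp
    have hxc : (x : ℂ) ≠ 0 := by exact_mod_cast hxpos.ne'
    have htc : (t : ℂ) ≠ 0 := by exact_mod_cast htpos.ne'
    have hac : (a : ℂ) ≠ 0 := by exact_mod_cast hP0.ne'
    have hxxc : (x : ℂ) * x = a / t := by exact_mod_cast hxx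
    -- Cholesky factor of P / √(det P); dividing by t = √(det P) is what puts the factor in SL₂.
    refine ⟨⟨!![(x : ℂ), P 0 1 / (t * x); 0, (x : ℂ)⁻¹], ?_⟩, (t : ℂ)⁻¹, inv_ne_zero htc, ?_⟩
    · rw [Matrix.det_fin_two_of]
      simp [hxc]
    · ext i j
      fin_cases i <;> fin_cases j
      · simp [Matrix.mul_apply, e00, hxxc]
        field_simp
      · simp [Matrix.mul_apply]
        field_simp
      · simp [Matrix.mul_apply, e10]
        field_simp
      · simp only [Matrix.mul_apply, Fin.sum_univ_two, Matrix.conjTranspose_apply]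
        simp
        rw [e11]
        have h1 : (starRingEnd ℂ) (P 0 1) * P 0 1 = a * (P 1 1).re - t * t := by
          rw [mul_comm, Complex.mul_conj]
          have : Complex.normSq (P 0 1) = a * (P 1 1).re - t * t := by rw [htD, hDe]; ring
          exact_mod_cast this
        have h2 : (starRingEnd ℂ) (P 0 1) / (t * x) * (P 0 1 / (t * x)) + (x : ℂ)⁻¹ * (x : ℂ)⁻¹ =
            ((starRingEnd ℂ) (P 0 1) * P 0 1 + t * t) / (t * t * (x * x)) := by
          field_simp
        rw [h2, h1, hxxc]
        field_simp
        ring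
  refine ⟨h, fun A hA => ?_⟩
  rw [Matrix.mem_unitaryGroup_iff', Matrix.star_eq_conjTranspose]
  have hhi : (h : Matrix (Fin 2) (Fin 2) ℂ) * ((h⁻¹ : SL(2, ℂ)) : Matrix (Fin 2) (Fin 2) ℂ) = 1 := by
    rw [← Matrix.SpecialLinearGroup.coe_mul, mul_inv_cancel, Matrix.SpecialLinearGroup.coe_one]
  have hih : ((h⁻¹ : SL(2, ℂ)) : Matrix (Fin 2) (Fin 2) ℂ)ᴴ * (h : Matrix (Fin 2) (Fin 2) ℂ)ᴴ = 1 := by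
    rw [← Matrix.conjTranspose_mul, hhi, Matrix.conjTranspose_one]
  rw [Matrix.SpecialLinearGroup.coe_mul, Matrix.SpecialLinearGroup.coe_mul,
    Matrix.conjTranspose_mul, Matrix.conjTranspose_mul]
  generalize ((h⁻¹ : SL(2, ℂ)) : Matrix (Fin 2) (Fin 2) ℂ) = hi at *
  have hA' := hinv A hA
  calc hiᴴ * ((A : Matrix (Fin 2) (Fin 2) ℂ)ᴴ * (h : Matrix (Fin 2) (Fin 2) ℂ)ᴴ) *
        ((h : Matrix (Fin 2) (Fin 2) ℂ) * (A : Matrix (Fin 2) (Fin 2) ℂ) * hi)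
      = hiᴴ * ((A : Matrix (Fin 2) (Fin 2) ℂ)ᴴ * ((h : Matrix (Fin 2) (Fin 2) ℂ)ᴴ *
        (h : Matrix (Fin 2) (Fin 2) ℂ)) * (A : Matrix (Fin 2) (Fin 2) ℂ)) * hi := by
        simp only [Matrix.mul_assoc]
    _ = hiᴴ * ((h : Matrix (Fin 2) (Fin 2) ℂ)ᴴ * (h : Matrix (Fin 2) (Fin 2) ℂ)) * hi := by
        rw [hh, Matrix.mul_smul, Matrix.smul_mul, hA']
    _ = (hiᴴ * (h : Matrix (Fin 2) (Fin 2) ℂ)ᴴ) * ((h : Matrix (Fin 2) (Fin 2) ℂ) * hi) := by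
        simp only [Matrix.mul_assoc]
    _ = 1 := by rw [hih, hhi, one_mul]

/-- If a nonscalar matrix commutes with a group, then this group fixes a point of `ℙ¹`. -/
theorem exists_fixed_of_commute (H : Subgroup PSL(2, ℂ)) (M : Matrix (Fin 2) (Fin 2) ℂ)
    (hM : ∀ c : ℂ, M ≠ c • (1 : Matrix (Fin 2) (Fin 2) ℂ))
    (hcomm : ∀ A : SL(2, ℂ), (QuotientGroup.mk A : PSL(2, ℂ)) ∈ H →
      M * (A : Matrix (Fin 2) (Fin 2) ℂ) = (A : Matrix (Fin 2) (Fin 2) ℂ) * M) :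
    ∃ p : ℙ ℂ (Fin 2 → ℂ), ∀ h ∈ H, h • p = p := by
  obtain ⟨c, hc⟩ := Module.End.exists_eigenvalue (Matrix.toLin' M)
  obtain ⟨v, hv⟩ := hc.exists_hasEigenvector
  have h1 := hv.apply_eq_smul
  rw [Matrix.toLin'_apply] at h1
  refine ⟨Projectivization.mk ℂ v hv.2, fun h hh => ?_⟩
  induction h using QuotientGroup.induction_on with | H A
  rw [PSL_smul_eq_mk_iff]
  -- Otherwise v and A v would be independent eigenvectors of `M` for the same eigenvalue c, and `M`
  -- would be the scalar c.
  by_contra hw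
  have h2 : M *ᵥ ((A : Matrix (Fin 2) (Fin 2) ℂ) *ᵥ v) = c • ((A : Matrix (Fin 2) (Fin 2) ℂ) *ᵥ v) := by
    rw [Matrix.mulVec_mulVec, hcomm A hh, ← Matrix.mulVec_mulVec, h1, Matrix.mulVec_smul]
  generalize (A : Matrix (Fin 2) (Fin 2) ℂ) *ᵥ v = w at *
  apply hM c
  have a0 := congrFun h1 0
  have a1 := congrFun h1 1
  have b0 := congrFun h2 0
  have b1 := congrFun h2 1
  simp only [Matrix.mulVec, dotProduct, Fin.sum_univ_two, Pi.smul_apply, smul_eq_mul] at a0 a1 b0 b1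
  unfold wedge at hw
  ext i j
  fin_cases i <;> fin_cases j
  · simp
    apply mul_left_cancel₀ hw
    linear_combination v 1 * b0 - w 1 * a0
  · simp
    apply (mul_eq_zero.1 (show (w 0 * v 1 - w 1 * v 0) * M 0 1 = 0 by
      linear_combination w 0 * a0 - v 0 * b0)).resolve_left hw
  · simp
    apply (mul_eq_zero.1 (show (w 0 * v 1 - w 1 * v 0) * M 1 0 = 0 by
      linear_combination v 1 * b1 - w 1 * a1)).resolve_left hw
  · simp
    apply mul_left_cancel₀ hw
    linear_combination w 0 * a1 - v 0 * b1

/-- Conjugate `H` into the unitary group by some h. If an element of `S` becomes a non-unitary k,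
then the conjugate of `H` remains unitary after a further conjugation by k, so it preserves both the
standard form and Q = kᴴ k. It therefore commutes with the nonscalar matrix Q and fixes its
eigenlines. -/
theorem isElementary_of_bounded {S : Set PSL(2, ℂ)} {H : Subgroup PSL(2, ℂ)}
    (hS : ∀ g ∈ S, ∀ h ∈ S, g * h⁻¹ ∈ H) (hc : ∀ g ∈ S, ∀ h ∈ H, g * h * g⁻¹ ∈ H)
    (C : ℝ) (hC : ∀ A : SL(2, ℂ), (QuotientGroup.mk A : PSL(2, ℂ)) ∈ H →
      ∀ i j, ‖(A : Matrix (Fin 2) (Fin 2) ℂ) i j‖ ≤ C) : IsElementary S := by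
  obtain ⟨h, hh⟩ := exists_conj_unitary (H.comap (QuotientGroup.mk' _)) C hC
  by_cases hall : ∀ A : SL(2, ℂ), (QuotientGroup.mk A : PSL(2, ℂ)) ∈ S →
      ((h * A * h⁻¹ : SL(2, ℂ)) : Matrix (Fin 2) (Fin 2) ℂ) ∈ Matrix.unitaryGroup (Fin 2) ℂ
  · refine Or.inl ⟨QuotientGroup.mk h, fun g hg => ?_⟩
    induction g using QuotientGroup.induction_on with | H A
    exact ⟨h * A * h⁻¹, hall A hg, rfl⟩
  · push Not at hall
    obtain ⟨A, hA, hAu⟩ := hall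
    set k : SL(2, ℂ) := h * A * h⁻¹ with hk
    set Q : Matrix (Fin 2) (Fin 2) ℂ := (k : Matrix (Fin 2) (Fin 2) ℂ)ᴴ * (k : Matrix (Fin 2) (Fin 2) ℂ)
    -- A scalar Q = c would satisfy c ≥ 0 and c² = det Q = 1, so Q = 1 and k would be unitary.
    have hns : ∀ c : ℂ, Q ≠ c • (1 : Matrix (Fin 2) (Fin 2) ℂ) := by
      intro c hcQ
      apply hAu
      rw [Matrix.mem_unitaryGroup_iff', Matrix.star_eq_conjTranspose]
      change Q = 1
      have hdet : Q.det = 1 := by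
        simp only [Q, Matrix.det_mul, Matrix.det_conjTranspose]
        simp
      have h00 : (c : ℂ) = ((Complex.normSq (k 0 0) + Complex.normSq (k 1 0) : ℝ) : ℂ) := by
        have := congrFun (congrFun hcQ 0) 0
        simp only [Q, Matrix.mul_apply, Fin.sum_univ_two, Matrix.conjTranspose_apply,
          Complex.star_def, ← Complex.normSq_eq_conj_mul_self] at this
        simp at this
        rw [← this]
        simp
      set r := Complex.normSq (k 0 0) + Complex.normSq (k 1 0)
      have hr : 0 ≤ r := add_nonneg (Complex.normSq_nonneg _) (Complex.normSq_nonneg _)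
      rw [hcQ, h00, Matrix.det_smul, Matrix.det_one] at hdet
      simp only [Fintype.card_fin, mul_one] at hdet
      have : r ^ 2 = 1 := by exact_mod_cast hdet
      have hr1 : r = 1 := (pow_eq_one_iff_of_nonneg hr two_ne_zero).1 this
      rw [hcQ, h00, hr1]
      simp
    have hQcomm : ∀ B : SL(2, ℂ), (QuotientGroup.mk B : PSL(2, ℂ)) ∈ H →
        Q * ((h * B * h⁻¹ : SL(2, ℂ)) : Matrix (Fin 2) (Fin 2) ℂ) =
          ((h * B * h⁻¹ : SL(2, ℂ)) : Matrix (Fin 2) (Fin 2) ℂ) * Q := by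
      intro B hB
      have hu := Matrix.mem_unitaryGroup_iff.1 (hh B hB)
      have hu2 := Matrix.mem_unitaryGroup_iff'.1 (hh (A * B * A⁻¹) (hc _ hA _ hB))
      have e1 : h * (A * B * A⁻¹) * h⁻¹ = k * (h * B * h⁻¹) * k⁻¹ := by
        rw [hk]; group
      rw [e1] at hu2
      generalize h * B * h⁻¹ = b at *
      have e2 : (k : Matrix (Fin 2) (Fin 2) ℂ) * (b : Matrix (Fin 2) (Fin 2) ℂ) =
          ((k * b * k⁻¹ : SL(2, ℂ)) : Matrix (Fin 2) (Fin 2) ℂ) * (k : Matrix (Fin 2) (Fin 2) ℂ) := by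
        rw [← Matrix.SpecialLinearGroup.coe_mul, ← Matrix.SpecialLinearGroup.coe_mul,
          inv_mul_cancel_right]
      generalize ((k * b * k⁻¹ : SL(2, ℂ)) : Matrix (Fin 2) (Fin 2) ℂ) = b' at *
      rw [Matrix.star_eq_conjTranspose] at hu hu2
      have e3 : (b : Matrix (Fin 2) (Fin 2) ℂ)ᴴ * Q * (b : Matrix (Fin 2) (Fin 2) ℂ) = Q := by
        calc _ = ((k : Matrix (Fin 2) (Fin 2) ℂ) * (b : Matrix (Fin 2) (Fin 2) ℂ))ᴴ *
              ((k : Matrix (Fin 2) (Fin 2) ℂ) * (b : Matrix (Fin 2) (Fin 2) ℂ)) := by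
              simp only [Q, Matrix.conjTranspose_mul, Matrix.mul_assoc]
          _ = (k : Matrix (Fin 2) (Fin 2) ℂ)ᴴ * (b'ᴴ * b') * (k : Matrix (Fin 2) (Fin 2) ℂ) := by
              rw [e2, Matrix.conjTranspose_mul]
              simp only [Matrix.mul_assoc]
          _ = Q := by rw [hu2, Matrix.mul_one]
      calc _ = ((b : Matrix (Fin 2) (Fin 2) ℂ) * (b : Matrix (Fin 2) (Fin 2) ℂ)ᴴ) *
            (Q * (b : Matrix (Fin 2) (Fin 2) ℂ)) := by rw [hu, one_mul]
        _ = (b : Matrix (Fin 2) (Fin 2) ℂ) * ((b : Matrix (Fin 2) (Fin 2) ℂ)ᴴ * Q *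
            (b : Matrix (Fin 2) (Fin 2) ℂ)) := by simp only [Matrix.mul_assoc]
        _ = _ := by rw [e3]
    have hi1 : ((h⁻¹ : SL(2, ℂ)) : Matrix (Fin 2) (Fin 2) ℂ) * (h : Matrix (Fin 2) (Fin 2) ℂ) = 1 := by
      rw [← Matrix.SpecialLinearGroup.coe_mul, inv_mul_cancel, Matrix.SpecialLinearGroup.coe_one]
    have hi2 : (h : Matrix (Fin 2) (Fin 2) ℂ) * ((h⁻¹ : SL(2, ℂ)) : Matrix (Fin 2) (Fin 2) ℂ) = 1 := by
      rw [← Matrix.SpecialLinearGroup.coe_mul, mul_inv_cancel, Matrix.SpecialLinearGroup.coe_one]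
    obtain ⟨p, hp⟩ := exists_fixed_of_commute H
      (((h⁻¹ : SL(2, ℂ)) : Matrix (Fin 2) (Fin 2) ℂ) * Q * (h : Matrix (Fin 2) (Fin 2) ℂ)) (by
        intro c hcM
        apply hns c
        calc Q = ((h : Matrix (Fin 2) (Fin 2) ℂ) * ((h⁻¹ : SL(2, ℂ)) : Matrix (Fin 2) (Fin 2) ℂ)) * Q *
              ((h : Matrix (Fin 2) (Fin 2) ℂ) * ((h⁻¹ : SL(2, ℂ)) : Matrix (Fin 2) (Fin 2) ℂ)) := by
              rw [hi2, one_mul, mul_one]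
          _ = (h : Matrix (Fin 2) (Fin 2) ℂ) * (((h⁻¹ : SL(2, ℂ)) : Matrix (Fin 2) (Fin 2) ℂ) * Q *
              (h : Matrix (Fin 2) (Fin 2) ℂ)) * ((h⁻¹ : SL(2, ℂ)) : Matrix (Fin 2) (Fin 2) ℂ) := by
              simp only [Matrix.mul_assoc]
          _ = c • 1 := by
              rw [hcM, Matrix.mul_smul, Matrix.smul_mul, mul_one, hi2]) (by
        intro B hB
        have := hQcomm B hB
        rw [Matrix.SpecialLinearGroup.coe_mul, Matrix.SpecialLinearGroup.coe_mul] at this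
        generalize ((h⁻¹ : SL(2, ℂ)) : Matrix (Fin 2) (Fin 2) ℂ) = hi at *
        generalize (h : Matrix (Fin 2) (Fin 2) ℂ) = ho at *
        generalize (B : Matrix (Fin 2) (Fin 2) ℂ) = b at *
        calc hi * Q * ho * b = hi * (Q * (ho * b * hi)) * ho := by
              simp only [Matrix.mul_assoc, hi1, mul_one]
          _ = (hi * ho) * b * (hi * Q * ho) := by
              rw [this]; simp only [Matrix.mul_assoc]
          _ = b * (hi * Q * ho) := by rw [hi1, one_mul])
    exact isElementary_of_fixed hS hc p hp

/-! ### Invariant functions -/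

/-- An element is determined by the images of three distinct points, so `H` embeds in F × F × F and
is finite. The size of the entries does not depend on the lift to SL₂. -/
theorem bounded_of_finite_invariant (H : Subgroup PSL(2, ℂ)) (F : Set (ℙ ℂ (Fin 2 → ℂ)))
    (hF : F.Finite) (hinv : ∀ h ∈ H, ∀ p ∈ F, h • p ∈ F) {p q r : ℙ ℂ (Fin 2 → ℂ)} (hp : p ∈ F)
    (hq : q ∈ F) (hr : r ∈ F) (hpq : p ≠ q) (hpr : p ≠ r) (hqr : q ≠ r) :
    ∃ C : ℝ, ∀ A : SL(2, ℂ), (QuotientGroup.mk A : PSL(2, ℂ)) ∈ H →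
      ∀ i j, ‖(A : Matrix (Fin 2) (Fin 2) ℂ) i j‖ ≤ C := by
  have hfin : (H : Set PSL(2, ℂ)).Finite := by
    have hm : Set.MapsTo (fun g : PSL(2, ℂ) => (g • p, g • q, g • r)) H (F ×ˢ F ×ˢ F) :=
      fun g hg => ⟨hinv g hg p hp, hinv g hg q hq, hinv g hg r hr⟩
    refine Set.Finite.of_finite_image ((hF.prod (hF.prod hF)).subset hm.image_subset) ?_
    intro g _ g' _ hgg
    simp only [Prod.mk.injEq] at hgg
    have := PSL_eq_one_of_three_fixed (g'⁻¹ * g) p q r hpq hpr hqr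
      (by rw [mul_smul, hgg.1, inv_smul_smul]) (by rw [mul_smul, hgg.2.1, inv_smul_smul])
      (by rw [mul_smul, hgg.2.2, inv_smul_smul])
    exact (inv_mul_eq_one.1 this).symm
  obtain ⟨C, hC⟩ := (hfin.image fun g : PSL(2, ℂ) =>
    ∑ i, ∑ j, ‖(Quotient.out g : SL(2, ℂ)) i j‖).bddAbove
  refine ⟨C, fun A hA i j => ?_⟩
  obtain ⟨s, hs, hAs⟩ := PSL_exists_smul_of_mk_eq
    (A := Quotient.out (QuotientGroup.mk A : PSL(2, ℂ))) (B := A) (QuotientGroup.out_eq' _)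
  refine le_trans ?_ (hC ⟨_, hA, rfl⟩)
  rw [hAs, Matrix.smul_apply, smul_eq_mul, norm_mul, hs, one_mul]
  refine le_trans ?_ (Finset.single_le_sum (f := fun i => ∑ j,
    ‖(Quotient.out (QuotientGroup.mk A : PSL(2, ℂ)) : SL(2, ℂ)) i j‖)
    (fun i _ => Finset.sum_nonneg fun j _ => norm_nonneg _) (Finset.mem_univ i))
  exact Finset.single_le_sum (f := fun j =>
    ‖(Quotient.out (QuotientGroup.mk A : PSL(2, ℂ)) : SL(2, ℂ)) i j‖)
    (fun j _ => norm_nonneg _) (Finset.mem_univ j)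

/-- Meant for the heavy points of m_0 and m_1. If `A = B`, this set is `S`-invariant. Otherwise,
with `H` unbounded, `A ∪ B` has at most two points, and one of the two sets misses a point of the
other: it is a singleton, hence a fixed point of `H`. -/
theorem isElementary_of_invariant_sets {S : Set PSL(2, ℂ)} {H : Subgroup PSL(2, ℂ)}
    (hS : ∀ g ∈ S, ∀ h ∈ S, g * h⁻¹ ∈ H) (hc : ∀ g ∈ S, ∀ h ∈ H, g * h * g⁻¹ ∈ H)
    (A B : Set (ℙ ℂ (Fin 2 → ℂ))) (hA : ∀ h ∈ H, ∀ p ∈ A, h • p ∈ A)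
    (hB : ∀ h ∈ H, ∀ p ∈ B, h • p ∈ B) (hAB : ∀ g ∈ S, ∀ p, p ∈ B ↔ g • p ∈ A)
    (hAfin : A.Finite)
    (hne : (¬ ∃ C : ℝ, ∀ A : SL(2, ℂ), (QuotientGroup.mk A : PSL(2, ℂ)) ∈ H →
      ∀ i j, ‖(A : Matrix (Fin 2) (Fin 2) ℂ) i j‖ ≤ C) → A.Nonempty) : IsElementary S := by
  by_cases hb : ∃ C : ℝ, ∀ A : SL(2, ℂ), (QuotientGroup.mk A : PSL(2, ℂ)) ∈ H →
      ∀ i j, ‖(A : Matrix (Fin 2) (Fin 2) ℂ) i j‖ ≤ C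
  · obtain ⟨C, hC⟩ := hb
    exact isElementary_of_bounded hS hc C hC
  specialize hne hb
  rcases S.eq_empty_or_nonempty with rfl | ⟨g, hg⟩
  · exact Or.inl ⟨1, by simp⟩
  by_cases hEq : B = A
  · exact IsElementary.of_finite A hAfin hne fun g hg p hp => (hAB g hg p).1 (hEq ▸ hp)
  have hBfin : B.Finite := by
    refine Set.Finite.of_finite_image (f := fun p => g • p) (hAfin.subset ?_)
      (MulAction.injective g).injOn
    rintro _ ⟨p, hp, rfl⟩
    exact (hAB g hg p).1 hp
  have hBne : B.Nonempty := by
    obtain ⟨a, ha⟩ := hne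
    exact ⟨g⁻¹ • a, (hAB g hg _).2 (by simpa using ha)⟩
  have hno : ∀ p ∈ A ∪ B, ∀ q ∈ A ∪ B, ∀ r ∈ A ∪ B, p ≠ q → p ≠ r → q = r := by
    intro p hp q hq r hr hpq hpr
    by_contra hqr
    refine hb (bounded_of_finite_invariant H (A ∪ B) (hAfin.union hBfin) ?_ hp hq hr hpq hpr hqr)
    rintro h hh x (hx | hx)
    · exact Or.inl (hA h hh x hx)
    · exact Or.inr (hB h hh x hx)
  have hfix : ∀ X Y : Set (ℙ ℂ (Fin 2 → ℂ)), X ⊆ A ∪ B → Y ⊆ A ∪ B → X.Nonempty →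
      (∀ h ∈ H, ∀ p ∈ X, h • p ∈ X) → (∃ y ∈ Y, y ∉ X) → IsElementary S := by
    rintro X Y hX hY ⟨x, hx⟩ hXH ⟨y, hyY, hyX⟩
    refine isElementary_of_fixed hS hc x fun h hh => ?_
    have hx' := hXH h hh x hx
    exact hno y (hY hyY) (h • x) (hX hx') x (hX hx) (fun e => hyX (e ▸ hx')) (fun e => hyX (e ▸ hx))
  by_cases hsub : B ⊆ A
  · have : ¬ A ⊆ B := fun h => hEq (hsub.antisymm h)
    exact hfix B A Set.subset_union_right Set.subset_union_left hBne hB (Set.not_subset.1 this)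
  · exact hfix A B Set.subset_union_left Set.subset_union_right hne hA (Set.not_subset.1 hsub)

/-! ### Finitely additive means on the projective line -/

/-- The square of the Hermitian norm. -/
def nsq (v : Fin 2 → ℂ) : ℝ := ‖v 0‖ ^ 2 + ‖v 1‖ ^ 2

theorem nsq_nonneg (v : Fin 2 → ℂ) : 0 ≤ nsq v := by unfold nsq; positivity

theorem eq_zero_of_nsq_le_zero {v : Fin 2 → ℂ} (h : nsq v ≤ 0) : v = 0 := by
  unfold nsq at h
  have h0 : ‖v 0‖ ^ 2 = 0 := le_antisymm (by nlinarith [sq_nonneg ‖v 1‖]) (sq_nonneg _)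
  have h1 : ‖v 1‖ ^ 2 = 0 := le_antisymm (by nlinarith [sq_nonneg ‖v 0‖]) (sq_nonneg _)
  ext i
  fin_cases i
  · simpa using h0
  · simpa using h1

theorem nsq_pos {v : Fin 2 → ℂ} (h : v ≠ 0) : 0 < nsq v :=
  lt_of_not_ge fun h0 => h (eq_zero_of_nsq_le_zero h0)

theorem nsq_smul (c : ℂ) (v : Fin 2 → ℂ) : nsq (c • v) = ‖c‖ ^ 2 * nsq v := by
  simp [nsq, mul_pow]
  ring

theorem norm_add_sq_le_two (x y : ℂ) : ‖x + y‖ ^ 2 ≤ 2 * (‖x‖ ^ 2 + ‖y‖ ^ 2) := by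
  have h1 := norm_add_le x y
  have h2 : ‖x + y‖ ^ 2 ≤ (‖x‖ + ‖y‖) ^ 2 := pow_le_pow_left₀ (norm_nonneg _) h1 2
  nlinarith [sq_nonneg (‖x‖ - ‖y‖)]

theorem nsq_add_le (v w : Fin 2 → ℂ) : nsq (v + w) ≤ 2 * (nsq v + nsq w) := by
  have h0 := norm_add_sq_le_two (v 0) (w 0)
  have h1 := norm_add_sq_le_two (v 1) (w 1)
  simp only [nsq, Pi.add_apply]
  linarith

theorem norm_mul_add_mul_sq_le (a b x y : ℂ) :
    ‖a * x + b * y‖ ^ 2 ≤ (‖a‖ ^ 2 + ‖b‖ ^ 2) * (‖x‖ ^ 2 + ‖y‖ ^ 2) := by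
  have h1 := norm_add_le (a * x) (b * y)
  rw [norm_mul, norm_mul] at h1
  have h2 : ‖a * x + b * y‖ ^ 2 ≤ (‖a‖ * ‖x‖ + ‖b‖ * ‖y‖) ^ 2 :=
    pow_le_pow_left₀ (norm_nonneg _) h1 2
  nlinarith [sq_nonneg (‖a‖ * ‖y‖ - ‖b‖ * ‖x‖)]

theorem norm_wedge_sq_le (v w : Fin 2 → ℂ) : ‖wedge v w‖ ^ 2 ≤ nsq v * nsq w := by
  have := norm_mul_add_mul_sq_le (v 0) (-v 1) (w 1) (w 0)
  rw [norm_neg] at this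
  unfold wedge nsq
  calc _ = ‖v 0 * w 1 + -v 1 * w 0‖ ^ 2 := by congr 2; ring
    _ ≤ _ := this
    _ = _ := by ring

/-- The sum of the squared absolute values of the entries of a matrix. -/
def entrySq (X : Matrix (Fin 2) (Fin 2) ℂ) : ℝ :=
  ‖X 0 0‖ ^ 2 + ‖X 0 1‖ ^ 2 + (‖X 1 0‖ ^ 2 + ‖X 1 1‖ ^ 2)

theorem nsq_mulVec_le (X : Matrix (Fin 2) (Fin 2) ℂ) (v : Fin 2 → ℂ) :
    nsq (X *ᵥ v) ≤ entrySq X * nsq v := by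
  simp only [nsq, entrySq, Matrix.mulVec, dotProduct, Fin.sum_univ_two]
  have h0 := norm_mul_add_mul_sq_le (X 0 0) (X 0 1) (v 0) (v 1)
  have h1 := norm_mul_add_mul_sq_le (X 1 0) (X 1 1) (v 0) (v 1)
  linarith

theorem entrySq_nonneg (X : Matrix (Fin 2) (Fin 2) ℂ) : 0 ≤ entrySq X := by
  unfold entrySq; positivity

theorem wedge_mulVec (A : SL(2, ℂ)) (v w : Fin 2 → ℂ) :
    wedge ((A : Matrix (Fin 2) (Fin 2) ℂ) *ᵥ v) ((A : Matrix (Fin 2) (Fin 2) ℂ) *ᵥ w) =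
      wedge v w := by
  have h := A.2
  rw [Matrix.det_fin_two] at h
  simp only [wedge, Matrix.mulVec, dotProduct, Fin.sum_univ_two]
  linear_combination (v 0 * w 1 - v 1 * w 0) * h

/-- Measurable subsets of the plane that are invariant by homotheties. -/
def IsMeasurableCone (B : Set (Fin 2 → ℂ)) : Prop :=
  MeasurableSet B ∧ ∀ c : ℂ, c ≠ 0 → ∀ v, c • v ∈ B ↔ v ∈ B

/-- The inverse image of a set by a matrix. -/
def matPreimage (A : SL(2, ℂ)) (B : Set (Fin 2 → ℂ)) : Set (Fin 2 → ℂ) :=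
  (fun v => (A : Matrix (Fin 2) (Fin 2) ℂ) *ᵥ v) ⁻¹' B

theorem IsMeasurableCone.preimage {B : Set (Fin 2 → ℂ)} (hB : IsMeasurableCone B) (A : SL(2, ℂ)) :
    IsMeasurableCone (matPreimage A B) := by
  refine ⟨?_, fun c hc v => ?_⟩
  · exact (Continuous.measurable (by fun_prop)) hB.1
  · simp only [matPreimage, Set.mem_preimage, Matrix.mulVec_smul]
    exact hB.2 c hc _

theorem matPreimage_mul (A B : SL(2, ℂ)) (X : Set (Fin 2 → ℂ)) :
    matPreimage (A * B) X = matPreimage B (matPreimage A X) := by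
  ext v
  simp only [matPreimage, Set.mem_preimage, Matrix.mulVec_mulVec, Matrix.SpecialLinearGroup.coe_mul]

theorem matPreimage_one (X : Set (Fin 2 → ℂ)) : matPreimage 1 X = X := by
  ext v
  simp [matPreimage]

theorem matPreimage_congr {A B : SL(2, ℂ)}
    (h : (QuotientGroup.mk A : PSL(2, ℂ)) = QuotientGroup.mk B) {X : Set (Fin 2 → ℂ)}
    (hX : IsMeasurableCone X) : matPreimage A X = matPreimage B X := by
  obtain ⟨r, hr, hAB⟩ := PSL_exists_smul_of_mk_eq h
  ext v
  simp only [matPreimage, Set.mem_preimage, hAB, Matrix.smul_mulVec]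
  exact (hX.2 r (fun h0 => by simp [h0] at hr) _).symm

/-- The cone of the vectors that are close to the line spanned by `w`. -/
def near (w : Fin 2 → ℂ) (ε : ℝ) : Set (Fin 2 → ℂ) := {v | ‖wedge v w‖ ^ 2 ≤ ε * nsq v}

theorem isMeasurableCone_near (w : Fin 2 → ℂ) (ε : ℝ) : IsMeasurableCone (near w ε) := by
  refine ⟨IsClosed.measurableSet (isClosed_le ?_ ?_), fun c hc v => ?_⟩
  · unfold wedge; fun_prop
  · unfold nsq; fun_prop
  · have h1 : wedge (c • v) w = c * wedge v w := by simp [wedge]; ring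
    have hc' : 0 < ‖c‖ ^ 2 := by positivity
    change ‖wedge (c • v) w‖ ^ 2 ≤ ε * nsq (c • v) ↔ ‖wedge v w‖ ^ 2 ≤ ε * nsq v
    rw [h1, nsq_smul, norm_mul, mul_pow, mul_left_comm, mul_le_mul_iff_right₀ hc']

/-- A finitely additive probability on the measurable subsets of `ℙ¹`, seen as cones of `ℂ²`. -/
structure IsConeMean (m : Set (Fin 2 → ℂ) → ℝ) : Prop where
  nonneg : ∀ B, IsMeasurableCone B → 0 ≤ m B
  univ : m Set.univ = 1
  mono : ∀ B B', IsMeasurableCone B → IsMeasurableCone B' → B ⊆ B' → m B ≤ m B'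
  union : ∀ B B', IsMeasurableCone B → IsMeasurableCone B' → B ∩ B' ⊆ {0} →
    m (B ∪ B') = m B + m B'

theorem IsMeasurableCone.union {B B' : Set (Fin 2 → ℂ)} (hB : IsMeasurableCone B)
    (hB' : IsMeasurableCone B') : IsMeasurableCone (B ∪ B') :=
  ⟨hB.1.union hB'.1, fun c hc v => or_congr (hB.2 c hc v) (hB'.2 c hc v)⟩

theorem IsMeasurableCone.compl {B : Set (Fin 2 → ℂ)} (hB : IsMeasurableCone B) :
    IsMeasurableCone Bᶜ :=
  ⟨hB.1.compl, fun c hc v => not_congr (hB.2 c hc v)⟩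

theorem isMeasurableCone_univ : IsMeasurableCone Set.univ :=
  ⟨MeasurableSet.univ, fun _ _ _ => Iff.rfl⟩

/-- The points of mass at least `1/2`. -/
def heavyPoints (m : Set (Fin 2 → ℂ) → ℝ) : Set (ℙ ℂ (Fin 2 → ℂ)) :=
  {p | ∀ ε > 0, 1 / 2 ≤ m (near p.rep ε)}

theorem near_smul {c : ℂ} (hc : c ≠ 0) (w : Fin 2 → ℂ) (ε : ℝ) :
    near (c • w) (‖c‖ ^ 2 * ε) = near w ε := by
  ext v
  have h1 : wedge v (c • w) = c * wedge v w := by simp [wedge]; ring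
  have hc' : 0 < ‖c‖ ^ 2 := by positivity
  change ‖wedge v (c • w)‖ ^ 2 ≤ _ ↔ ‖wedge v w‖ ^ 2 ≤ ε * nsq v
  rw [h1, norm_mul, mul_pow, mul_assoc, mul_le_mul_iff_right₀ hc']

/-- Changing the representative vector only rescales ε, and every ε > 0 is tested. -/
theorem mk_mem_heavyPoints (m : Set (Fin 2 → ℂ) → ℝ) {v : Fin 2 → ℂ} (hv : v ≠ 0) :
    Projectivization.mk ℂ v hv ∈ heavyPoints m ↔ ∀ ε > 0, 1 / 2 ≤ m (near v ε) := by
  obtain ⟨a, ha⟩ := Projectivization.exists_smul_eq_mk_rep ℂ v hv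
  have ha0 : (a : ℂ) ≠ 0 := a.ne_zero
  have hap : 0 < ‖(a : ℂ)‖ ^ 2 := by positivity
  have hv' : (Projectivization.mk ℂ v hv).rep = (a : ℂ) • v := ha.symm
  unfold heavyPoints
  rw [Set.mem_ofPred_eq, hv']
  constructor
  · intro h ε hε
    rw [← near_smul ha0]
    exact h _ (mul_pos hap hε)
  · intro h ε hε
    have : ε = ‖(a : ℂ)‖ ^ 2 * (ε / ‖(a : ℂ)‖ ^ 2) := by field_simp
    rw [this, near_smul ha0]
    exact h _ (div_pos hε hap)

/-- `A` preserves `wedge` and, like its inverse, changes `nsq` by a bounded factor, so it exchanges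
the bases of neighbourhoods of p and of its image. -/
theorem IsConeMean.heavyPoints_smul {m m' : Set (Fin 2 → ℂ) → ℝ}
    (hm' : IsConeMean m') (A : SL(2, ℂ))
    (h : ∀ B, IsMeasurableCone B → m' (matPreimage A B) = m B) (p : ℙ ℂ (Fin 2 → ℂ)) :
    p ∈ heavyPoints m' ↔ (QuotientGroup.mk A : PSL(2, ℂ)) • p ∈ heavyPoints m := by
  induction p using Projectivization.ind with | h v hv
  rw [PSL_smul_mk, mk_mem_heavyPoints, mk_mem_heavyPoints]
  constructor
  · intro hp ε hε
    set K := entrySq ((A⁻¹ : SL(2, ℂ)) : Matrix (Fin 2) (Fin 2) ℂ) + 1 with hK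
    have hKpos : 0 < K := by have := entrySq_nonneg ((A⁻¹ : SL(2, ℂ)) : Matrix (Fin 2) (Fin 2) ℂ); linarith
    rw [← h _ (isMeasurableCone_near _ _)]
    refine (hp (ε / K) (div_pos hε hKpos)).trans (hm'.mono _ _ (isMeasurableCone_near _ _)
      ((isMeasurableCone_near _ _).preimage A) ?_)
    intro u hu
    change ‖wedge u v‖ ^ 2 ≤ ε / K * nsq u at hu
    change ‖wedge ((A : Matrix (Fin 2) (Fin 2) ℂ) *ᵥ u) ((A : Matrix (Fin 2) (Fin 2) ℂ) *ᵥ v)‖ ^ 2 ≤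
      ε * nsq ((A : Matrix (Fin 2) (Fin 2) ℂ) *ᵥ u)
    rw [wedge_mulVec]
    refine hu.trans ?_
    have h1 := nsq_mulVec_le ((A⁻¹ : SL(2, ℂ)) : Matrix (Fin 2) (Fin 2) ℂ)
      ((A : Matrix (Fin 2) (Fin 2) ℂ) *ᵥ u)
    rw [Matrix.mulVec_mulVec, ← Matrix.SpecialLinearGroup.coe_mul, inv_mul_cancel,
      Matrix.SpecialLinearGroup.coe_one, Matrix.one_mulVec] at h1
    have h2 : nsq u ≤ K * nsq ((A : Matrix (Fin 2) (Fin 2) ℂ) *ᵥ u) := by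
      have := nsq_nonneg ((A : Matrix (Fin 2) (Fin 2) ℂ) *ᵥ u)
      rw [hK, add_mul]
      linarith
    calc ε / K * nsq u ≤ ε / K * (K * nsq ((A : Matrix (Fin 2) (Fin 2) ℂ) *ᵥ u)) :=
          mul_le_mul_of_nonneg_left h2 (div_pos hε hKpos).le
      _ = _ := by field_simp
  · intro hp ε hε
    set K := entrySq (A : Matrix (Fin 2) (Fin 2) ℂ) + 1 with hK
    have hKpos : 0 < K := by have := entrySq_nonneg (A : Matrix (Fin 2) (Fin 2) ℂ); linarith
    have := hp (ε / K) (div_pos hε hKpos)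
    rw [← h _ (isMeasurableCone_near _ _)] at this
    refine this.trans (hm'.mono _ _ ((isMeasurableCone_near _ _).preimage A)
      (isMeasurableCone_near _ _) ?_)
    intro u hu
    change ‖wedge ((A : Matrix (Fin 2) (Fin 2) ℂ) *ᵥ u) ((A : Matrix (Fin 2) (Fin 2) ℂ) *ᵥ v)‖ ^ 2 ≤
      ε / K * nsq ((A : Matrix (Fin 2) (Fin 2) ℂ) *ᵥ u) at hu
    change ‖wedge u v‖ ^ 2 ≤ ε * nsq u
    rw [wedge_mulVec] at hu
    refine hu.trans ?_
    have h1 := nsq_mulVec_le (A : Matrix (Fin 2) (Fin 2) ℂ) u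
    have h2 : nsq ((A : Matrix (Fin 2) (Fin 2) ℂ) *ᵥ u) ≤ K * nsq u := by
      have := nsq_nonneg u
      rw [hK, add_mul]
      linarith
    calc ε / K * nsq ((A : Matrix (Fin 2) (Fin 2) ℂ) *ᵥ u) ≤ ε / K * (K * nsq u) :=
          mul_le_mul_of_nonneg_left h2 (div_pos hε hKpos).le
      _ = _ := by field_simp

/-- By Cramer's rule (`e`), a vector close to both lines is small compared with itself. The origin
lies in every such cone, which is why disjointness is only meant away from 0. The 4 in the choice of
ε beats the 2 of `nsq_add_le`. -/
theorem exists_near_inter_subset {v w : Fin 2 → ℂ} (h : wedge v w ≠ 0) :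
    ∃ ε > 0, ∀ δ ≤ ε, near v δ ∩ near w δ ⊆ {0} := by
  have hw : 0 < ‖wedge v w‖ ^ 2 := by positivity
  have hs : 0 < nsq v + nsq w := by
    have := norm_wedge_sq_le v w
    have h1 := nsq_nonneg v
    have h2 := nsq_nonneg w
    nlinarith
  refine ⟨‖wedge v w‖ ^ 2 / (4 * (nsq v + nsq w)), by positivity, fun δ hδ u hu => ?_⟩
  obtain ⟨h1, h2⟩ := hu
  change ‖wedge u v‖ ^ 2 ≤ δ * nsq u at h1
  change ‖wedge u w‖ ^ 2 ≤ δ * nsq u at h2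
  refine eq_zero_of_nsq_le_zero ?_
  have e : wedge v w • u = wedge u w • v + (-wedge u v) • w := by
    ext i
    fin_cases i <;> simp [wedge] <;> ring
  have h3 := nsq_add_le (wedge u w • v) ((-wedge u v) • w)
  rw [← e, nsq_smul, nsq_smul, nsq_smul, norm_neg] at h3
  rw [le_div_iff₀ (by positivity)] at hδ
  have h4 := mul_le_mul_of_nonneg_right h1 (nsq_nonneg w)
  have h5 := mul_le_mul_of_nonneg_right h2 (nsq_nonneg v)
  have h6 := mul_le_mul_of_nonneg_right hδ (nsq_nonneg u)
  have h7 : ‖wedge v w‖ ^ 2 * nsq u ≤ 0 := by nlinarith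
  by_contra h8
  push Not at h8
  exact absurd (mul_pos hw h8) (not_lt.2 h7)

/-- Three heavy points would have disjoint neighbourhoods of total mass at least 3/2. -/
theorem IsConeMean.finite_heavyPoints {m : Set (Fin 2 → ℂ) → ℝ} (hm : IsConeMean m) :
    (heavyPoints m).Finite := by
  classical
  by_contra hinf
  obtain ⟨t, ht, hcard⟩ := Set.Infinite.exists_subset_card_eq hinf 3
  obtain ⟨p, q, r, hpq, hpr, hqr, rfl⟩ := Finset.card_eq_three.1 hcard
  have hp : p ∈ heavyPoints m := ht (by simp)
  have hq : q ∈ heavyPoints m := ht (by simp)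
  have hr : r ∈ heavyPoints m := ht (by simp)
  clear ht hcard
  induction p using Projectivization.ind with | h v hv
  induction q using Projectivization.ind with | h w hw
  induction r using Projectivization.ind with | h x hx
  rw [mk_mem_heavyPoints] at hp hq hr
  rw [Ne, Projectivization.mk_eq_mk_iff_wedge] at hpq hpr hqr
  obtain ⟨ε₁, h1, h1'⟩ := exists_near_inter_subset hpq
  obtain ⟨ε₂, h2, h2'⟩ := exists_near_inter_subset hpr
  obtain ⟨ε₃, h3, h3'⟩ := exists_near_inter_subset hqr
  set ε := min ε₁ (min ε₂ ε₃) with hε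
  have hεpos : 0 < ε := lt_min h1 (lt_min h2 h3)
  have cv := isMeasurableCone_near v ε
  have cw := isMeasurableCone_near w ε
  have cx := isMeasurableCone_near x ε
  have e1 := hm.union _ _ cv cw (h1' ε (min_le_left _ _))
  have e2 := hm.union _ _ (cv.union cw) cx (by
    rw [Set.union_inter_distrib_right]
    exact Set.union_subset (h2' ε ((min_le_right _ _).trans (min_le_left _ _)))
      (h3' ε ((min_le_right _ _).trans (min_le_right _ _))))
  have e3 := hm.mono _ _ ((cv.union cw).union cx) isMeasurableCone_univ (Set.subset_univ _)
  have := hp ε hεpos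
  have := hq ε hεpos
  have := hr ε hεpos
  rw [hm.univ, e2, e1] at e3
  linarith

/-! ### Contraction by large matrices, and elementarity from means -/

theorem exists_rank_one {X : Matrix (Fin 2) (Fin 2) ℂ} (hX : X ≠ 0) (hdet : X.det = 0) :
    ∃ a b : Fin 2 → ℂ, a ≠ 0 ∧ b ≠ 0 ∧ ∀ v, X *ᵥ v = wedge v b • a := by
  rw [Matrix.det_fin_two] at hdet
  by_cases h0 : X 0 = 0
  · have h00 : X 0 0 = 0 := congrFun h0 0
    have h01 : X 0 1 = 0 := congrFun h0 1
    refine ⟨![0, 1], ![-X 1 1, X 1 0], by simp, fun hb => hX ?_, fun v => ?_⟩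
    · have b0 := congrFun hb 0
      have b1 := congrFun hb 1
      simp at b0 b1
      ext i j
      fin_cases i <;> fin_cases j <;> simp [h00, h01, b0, b1]
    · ext i
      fin_cases i <;> simp [Matrix.mulVec, dotProduct, h00, h01, wedge]
      ring
  · obtain ⟨c, hc⟩ := exists_smul_eq_of_wedge_eq_zero (v := X 1) h0 (by
      unfold wedge
      linear_combination -hdet)
    have c0 : X 1 0 = c * X 0 0 := congrFun hc 0
    have c1 : X 1 1 = c * X 0 1 := congrFun hc 1
    refine ⟨![1, c], ![-X 0 1, X 0 0], by simp, fun hb => h0 ?_, fun v => ?_⟩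
    · have b0 := congrFun hb 0
      have b1 := congrFun hb 1
      simp at b0 b1
      ext j
      fin_cases j <;> simp [b0, b1]
    · ext i
      fin_cases i <;> simp [Matrix.mulVec, dotProduct, wedge, c0, c1] <;> ring

/-- Large elements of `SL₂(ℂ)` send the complement of a neighbourhood of a point in a small
neighbourhood of another one. -/
theorem exists_contraction (K : Set SL(2, ℂ))
    (hK : ¬ ∃ C : ℝ, ∀ A ∈ K, ∀ i j, ‖(A : Matrix (Fin 2) (Fin 2) ℂ) i j‖ ≤ C) :
    ∃ a b : Fin 2 → ℂ, a ≠ 0 ∧ b ≠ 0 ∧ ∀ ε > 0, ∀ δ > 0, ∃ A ∈ K,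
      (near b ε)ᶜ ⊆ matPreimage A (near a δ) := by
  have hseq : ∀ k : ℕ, ∃ A ∈ K, (k : ℝ) < ‖(A : Matrix (Fin 2) (Fin 2) ℂ)‖ := by
    intro k
    push Not at hK
    obtain ⟨A, hA, i, j, hij⟩ := hK k
    exact ⟨A, hA, hij.trans_le (Matrix.norm_entry_le_entrywise_sup_norm _)⟩
  choose A hAK hAn using hseq
  set n : ℕ → ℝ := fun k => ‖(A k : Matrix (Fin 2) (Fin 2) ℂ)‖ with hn
  have hnpos : ∀ k, 0 < n k := fun k => (Nat.cast_nonneg k).trans_lt (hAn k)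
  have hntop : Filter.Tendsto n Filter.atTop Filter.atTop :=
    Filter.tendsto_atTop_mono (fun k => (hAn k).le) tendsto_natCast_atTop_atTop
  -- The normalised matrices have determinant n⁻² → 0, so any limit point has rank one, with image
  -- spanned by a and kernel spanned by b.
  set X : ℕ → Matrix (Fin 2) (Fin 2) ℂ := fun k => ((n k)⁻¹ : ℂ) • (A k : Matrix (Fin 2) (Fin 2) ℂ)
    with hXdef
  have hXs : ∀ k, X k ∈ Metric.sphere (0 : Matrix (Fin 2) (Fin 2) ℂ) 1 := by
    intro k
    rw [mem_sphere_zero_iff_norm]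
    simp only [hXdef]
    rw [norm_smul, norm_inv, Complex.norm_real, Real.norm_of_nonneg (hnpos k).le]
    exact inv_mul_cancel₀ (hnpos k).ne'
  obtain ⟨Y, hY, φ, hφ, hlim⟩ := (isCompact_sphere (0 : Matrix (Fin 2) (Fin 2) ℂ) 1).tendsto_subseq hXs
  have hY0 : Y ≠ 0 := by
    rintro rfl
    simp at hY
  have hYdet : Y.det = 0 := by
    have h1 : Filter.Tendsto (fun k => (X (φ k)).det) Filter.atTop (nhds Y.det) :=
      ((continuous_id.matrix_det).tendsto Y).comp hlim
    have h2 : Filter.Tendsto (fun k => (X (φ k)).det) Filter.atTop (nhds 0) := by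
      have e : ∀ k, (X (φ k)).det = (((n (φ k))⁻¹ ^ 2 : ℝ) : ℂ) := by
        intro k
        simp only [hXdef, Matrix.det_smul, Fintype.card_fin, Matrix.SpecialLinearGroup.det_coe]
        push_cast
        ring
      simp only [e]
      rw [← Complex.ofReal_zero]
      refine (Complex.continuous_ofReal.tendsto 0).comp ?_
      have := ((tendsto_inv_atTop_zero.comp hntop).comp hφ.tendsto_atTop).pow 2
      simpa using this
    exact tendsto_nhds_unique h1 h2
  obtain ⟨a, b, ha, hb, hab⟩ := exists_rank_one hY0 hYdet
  refine ⟨a, b, ha, hb, fun ε hε δ hδ => ?_⟩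
  have hna := nsq_pos ha
  have herr : Filter.Tendsto (fun k => entrySq (X (φ k) - Y)) Filter.atTop (nhds 0) := by
    have hc : Continuous fun Z : Matrix (Fin 2) (Fin 2) ℂ => entrySq (Z - Y) := by
      unfold entrySq
      have h : ∀ i j, Continuous fun Z : Matrix (Fin 2) (Fin 2) ℂ => (Z - Y) i j := fun i j =>
        (continuous_id.sub continuous_const).matrix_elem i j
      exact ((((h 0 0).norm.pow 2).add ((h 0 1).norm.pow 2)).add
        (((h 1 0).norm.pow 2).add ((h 1 1).norm.pow 2)))
    have h0 : entrySq (Y - Y) = 0 := by simp [entrySq]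
    have := (hc.tendsto Y).comp hlim
    rw [h0] at this
    exact this
  -- An error η below this threshold satisfies η · nsq a ≤ δ (ε · nsq a / 2 - η): the left side
  -- bounds the deviation from the line of a, while the right side is δ times the lower bound for
  -- the length of the image (both relative to `nsq v`).
  have hτ : 0 < δ * (ε * nsq a / 2) / (nsq a + δ) := by positivity
  obtain ⟨k, hk⟩ := (herr.eventually (gt_mem_nhds hτ)).exists
  refine ⟨A (φ k), hAK _, fun v hv => ?_⟩
  set η := entrySq (X (φ k) - Y) with hη
  rw [lt_div_iff₀ (by positivity)] at hk
  have hv' : ε * nsq v < ‖wedge v b‖ ^ 2 := lt_of_not_ge hv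
  set e := (X (φ k) - Y) *ᵥ v with he
  have he1 : nsq e ≤ η * nsq v := nsq_mulVec_le _ _
  have hXv : X (φ k) *ᵥ v = wedge v b • a + e := by
    rw [he, Matrix.sub_mulVec, hab]
    abel
  have h1 : ‖wedge (X (φ k) *ᵥ v) a‖ ^ 2 ≤ η * nsq v * nsq a := by
    have : wedge (X (φ k) *ᵥ v) a = wedge e a := by
      rw [hXv]
      simp [wedge]
      ring
    rw [this]
    exact (norm_wedge_sq_le _ _).trans (mul_le_mul_of_nonneg_right he1 (nsq_nonneg a))
  have h2 : ‖wedge v b‖ ^ 2 * nsq a ≤ 2 * (nsq (X (φ k) *ᵥ v) + η * nsq v) := by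
    have h3 := nsq_add_le (X (φ k) *ᵥ v) (-e)
    have h4 : X (φ k) *ᵥ v + -e = wedge v b • a := by rw [hXv]; abel
    have h5 : nsq (-e) = nsq e := by simp [nsq]
    rw [h4, nsq_smul, h5] at h3
    linarith
  have h3 : ‖wedge (X (φ k) *ᵥ v) a‖ ^ 2 ≤ δ * nsq (X (φ k) *ᵥ v) := by
    have h4 := mul_le_mul_of_nonneg_right hv'.le hna.le
    have h5 := mul_le_mul_of_nonneg_right hk.le (nsq_nonneg v)
    nlinarith
  have h4 : X (φ k) *ᵥ v = ((n (φ k))⁻¹ : ℂ) • ((A (φ k) : Matrix (Fin 2) (Fin 2) ℂ) *ᵥ v) := by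
    simp only [hXdef, Matrix.smul_mulVec]
  have h5 : X (φ k) *ᵥ v ∈ near a δ := h3
  rw [h4] at h5
  refine ((isMeasurableCone_near a δ).2 _ ?_ _).1 h5
  exact inv_ne_zero (by exact_mod_cast (hnpos _).ne')

/-- The elements of `S` need not preserve a single mean, but they all carry `M (N + 1)` to `M N`;
the argument runs on the common stabiliser of all the means. -/
theorem isElementary_of_coneMeans {S : Set PSL(2, ℂ)} (M : ℕ → Set (Fin 2 → ℂ) → ℝ)
    (hM : ∀ N, IsConeMean (M N))
    (hS : ∀ A : SL(2, ℂ), (QuotientGroup.mk A : PSL(2, ℂ)) ∈ S → ∀ N B, IsMeasurableCone B →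
      M (N + 1) (matPreimage A B) = M N B) : IsElementary S := by
  -- All indices are required at once: invariance of `M N` by g h g⁻¹ comes from invariance of `M (N
  -- + 1)` by h.
  let K : Subgroup SL(2, ℂ) :=
    { carrier := {A | ∀ N B, IsMeasurableCone B → M N (matPreimage A B) = M N B}
      mul_mem' := by
        intro A A' hA hA' N B hB
        rw [matPreimage_mul, hA' N _ (hB.preimage A), hA N B hB]
      one_mem' := by
        intro N B _
        rw [matPreimage_one]
      inv_mem' := by
        intro A hA N B hB
        rw [← hA N _ (hB.preimage _), ← matPreimage_mul, inv_mul_cancel, matPreimage_one] }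
  let H : Subgroup PSL(2, ℂ) := K.map (QuotientGroup.mk' _)
  have hH : ∀ A : SL(2, ℂ), (QuotientGroup.mk A : PSL(2, ℂ)) ∈ H ↔ A ∈ K := by
    intro A
    refine ⟨?_, fun h => ⟨A, h, rfl⟩⟩
    rintro ⟨A', hA', e⟩ N B hB
    rw [← matPreimage_congr (show (QuotientGroup.mk A' : PSL(2, ℂ)) = QuotientGroup.mk A from e) hB]
    exact hA' N B hB
  have hSS : ∀ g ∈ S, ∀ h ∈ S, g * h⁻¹ ∈ H := by
    intro g hg h hh
    induction g using QuotientGroup.induction_on with | H A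
    induction h using QuotientGroup.induction_on with | H A'
    refine (hH (A * A'⁻¹)).2 fun N B hB => ?_
    rw [← hS A' hh N _ (hB.preimage _), ← matPreimage_mul, inv_mul_cancel_right, hS A hg N B hB]
  have hconj : ∀ g ∈ S, ∀ h ∈ H, g * h * g⁻¹ ∈ H := by
    intro g hg h hh
    induction g using QuotientGroup.induction_on with | H A
    induction h using QuotientGroup.induction_on with | H A'
    rw [hH] at hh
    refine (hH (A * A' * A⁻¹)).2 fun N B hB => ?_
    rw [← hS A hg N _ (hB.preimage _), ← matPreimage_mul, inv_mul_cancel_right, matPreimage_mul,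
      hh _ _ (hB.preimage _), hS A hg N B hB]
  have hinv : ∀ N, ∀ h ∈ H, ∀ p ∈ heavyPoints (M N), h • p ∈ heavyPoints (M N) := by
    intro N h hh p hp
    induction h using QuotientGroup.induction_on with | H A
    exact ((hM N).heavyPoints_smul A (fun B hB => (hH A).1 hh N B hB) p).1 hp
  refine isElementary_of_invariant_sets hSS hconj (heavyPoints (M 0)) (heavyPoints (M 1))
    (hinv 0) (hinv 1) ?_ (hM 0).finite_heavyPoints ?_
  · intro g hg p
    induction g using QuotientGroup.induction_on with | H A
    exact (hM 1).heavyPoints_smul A (fun B hB => hS A hg 0 B hB) p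
  · intro hunb
    simp only [hH] at hunb
    obtain ⟨a, b, ha, hb, hab⟩ := exists_contraction K hunb
    -- If a is not heavy, it has a neighbourhood of mass < 1/2. Some element of `K` sends the
    -- complement of any given neighbourhood of b into it, so by invariance that neighbourhood of b
    -- has mass > 1/2.
    by_cases hna : Projectivization.mk ℂ a ha ∈ heavyPoints (M 0)
    · exact ⟨_, hna⟩
    · refine ⟨Projectivization.mk ℂ b hb, ?_⟩
      rw [mk_mem_heavyPoints] at hna ⊢
      push Not at hna
      obtain ⟨δ, hδ, hlt⟩ := hna
      intro ε hε
      obtain ⟨A, hA, hsub⟩ := hab ε hε δ hδ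
      have cb := isMeasurableCone_near b ε
      have h1 := (hM 0).mono _ _ cb.compl ((isMeasurableCone_near a δ).preimage A) hsub
      rw [hA 0 _ (isMeasurableCone_near a δ)] at h1
      have h2 := (hM 0).union _ _ cb cb.compl (by simp)
      rw [Set.union_compl_self, (hM 0).univ] at h2
      linarith

/-! ### The action on the affine coordinate -/

theorem SL_secondCountable : SecondCountableTopology SL(2, ℂ) := by
  have : SecondCountableTopology (Matrix (Fin 2) (Fin 2) ℂ) :=
    inferInstanceAs (SecondCountableTopology (Fin 2 → Fin 2 → ℂ))
  exact Topology.IsInducing.subtypeVal.secondCountableTopology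

/-- Makes multiplication jointly measurable for the product σ-algebra, as convolution requires. -/
instance PSL_secondCountable : SecondCountableTopology PSL(2, ℂ) :=
  have := SL_secondCountable
  QuotientGroup.instSecondCountableTopology _

/-- The product of two entries, which is well defined on `PSL₂(ℂ)`. -/
def entryProd (i j k l : Fin 2) (g : PSL(2, ℂ)) : ℂ :=
  Quotient.liftOn' g (fun A : SL(2, ℂ) => A i j * A k l) fun A B h => by
    obtain ⟨r, hr, hC⟩ := Matrix.SpecialLinearGroup.mem_center_iff.1
      (QuotientGroup.leftRel_apply.1 h)
    have hB : (B : Matrix (Fin 2) (Fin 2) ℂ) = r • (A : Matrix (Fin 2) (Fin 2) ℂ) := by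
      have h2 : (B : Matrix (Fin 2) (Fin 2) ℂ)
          = (A : Matrix (Fin 2) (Fin 2) ℂ) *
            ((A⁻¹ * B : SL(2, ℂ)) : Matrix (Fin 2) (Fin 2) ℂ) := by
        rw [← Matrix.SpecialLinearGroup.coe_mul, mul_inv_cancel_left]
      rw [h2, ← hC, Matrix.scalar_apply, ← Matrix.smul_one_eq_diagonal, Matrix.mul_smul, mul_one]
    simp only [Fintype.card_fin] at hr
    simp only [hB, Matrix.smul_apply, smul_eq_mul]
    linear_combination (-(A : Matrix (Fin 2) (Fin 2) ℂ) i j * (A : Matrix (Fin 2) (Fin 2) ℂ) k l) * hr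

theorem continuous_entryProd (i j k l : Fin 2) : Continuous (entryProd i j k l) := by
  refine continuous_quot_lift _ ?_
  exact (SL_continuous_coe.matrix_elem i j).mul (SL_continuous_coe.matrix_elem k l)

/-- The square `(c z + d)²` of the denominator of a homography. -/
def denomSq (g : PSL(2, ℂ)) (z : ℂ) : ℂ :=
  entryProd 1 0 1 0 g * z ^ 2 + 2 * entryProd 1 0 1 1 g * z + entryProd 1 1 1 1 g

/-- The homography `z ↦ (a z + b) / (c z + d)`, with value `0` at its pole. -/
def homography (g : PSL(2, ℂ)) (z : ℂ) : ℂ :=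
  (entryProd 0 0 1 0 g * z ^ 2 + (entryProd 0 0 1 1 g + entryProd 0 1 1 0 g) * z +
    entryProd 0 1 1 1 g) / denomSq g z

theorem denomSq_mk (A : SL(2, ℂ)) (z : ℂ) :
    denomSq (QuotientGroup.mk A) z = (A 1 0 * z + A 1 1) ^ 2 := by
  change A 1 0 * A 1 0 * z ^ 2 + 2 * (A 1 0 * A 1 1) * z + A 1 1 * A 1 1 = _
  ring

/-- In the definition, numerator and denominator carry an extra factor c z + d, because the entries
are defined up to sign and only their products descend to PSL₂. -/
theorem homography_mk (A : SL(2, ℂ)) (z : ℂ) :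
    homography (QuotientGroup.mk A) z = (A 0 0 * z + A 0 1) / (A 1 0 * z + A 1 1) := by
  unfold homography
  rw [denomSq_mk]
  change (A 0 0 * A 1 0 * z ^ 2 + (A 0 0 * A 1 1 + A 0 1 * A 1 0) * z + A 0 1 * A 1 1) / _ = _
  by_cases h : A 1 0 * z + A 1 1 = 0
  · rw [h]; simp
  · field_simp
    ring

section Measurability

variable [MeasurableSpace PSL(2, ℂ)] [BorelSpace PSL(2, ℂ)]

theorem measurable_denomSq : Measurable fun p : PSL(2, ℂ) × ℂ => denomSq p.1 p.2 := by
  have h : ∀ i j k l, Measurable fun p : PSL(2, ℂ) × ℂ => entryProd i j k l p.1 := fun i j k l =>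
    (continuous_entryProd i j k l).measurable.comp measurable_fst
  unfold denomSq
  have := h 1 0 1 0
  have := h 1 0 1 1
  have := h 1 1 1 1
  fun_prop

theorem measurable_homography : Measurable fun p : PSL(2, ℂ) × ℂ => homography p.1 p.2 := by
  have h : ∀ i j k l, Measurable fun p : PSL(2, ℂ) × ℂ => entryProd i j k l p.1 := fun i j k l =>
    (continuous_entryProd i j k l).measurable.comp measurable_fst
  unfold homography
  have := h 0 0 1 0
  have := h 0 0 1 1
  have := h 0 1 1 0
  have := h 0 1 1 1
  have := measurable_denomSq
  fun_prop

end Measurability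

theorem measure_setOf_mul_add_eq_zero {c d : ℂ} (h : c ≠ 0 ∨ d ≠ 0) :
    volume {z : ℂ | c * z + d = 0} = 0 := by
  refine Set.Subsingleton.measure_zero (fun z hz w hw => ?_) _
  change c * z + d = 0 at hz
  change c * w + d = 0 at hw
  by_cases hc : c = 0
  · subst hc
    simp at hz h
    exact absurd hz h
  · exact mul_left_cancel₀ hc (by linear_combination hz - hw)

theorem SL_det_eq (A : SL(2, ℂ)) : A 0 0 * A 1 1 - A 0 1 * A 1 0 = 1 := by
  have h := A.2
  rwa [Matrix.det_fin_two] at h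

theorem SL_mulVec_affine (A : SL(2, ℂ)) {z : ℂ} (hd : A 1 0 * z + A 1 1 ≠ 0) :
    (A : Matrix (Fin 2) (Fin 2) ℂ) *ᵥ ![z, 1] =
      (A 1 0 * z + A 1 1) • ![(A 0 0 * z + A 0 1) / (A 1 0 * z + A 1 1), 1] := by
  ext i
  fin_cases i
  · simp [Matrix.mulVec, dotProduct, mul_div_cancel₀ _ hd]
  · simp [Matrix.mulVec, dotProduct]

theorem ae_denomSq_ne_zero (g : PSL(2, ℂ)) : ∀ᵐ z : ℂ, denomSq g z ≠ 0 := by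
  induction g using QuotientGroup.induction_on with | H A
  simp only [denomSq_mk, ne_eq, pow_eq_zero_iff two_ne_zero]
  rw [ae_iff]
  simp only [not_not]
  refine measure_setOf_mul_add_eq_zero ?_
  by_contra! h
  have := SL_det_eq A
  rw [h.1, h.2] at this
  simp at this

/-- Change of variables: the complex derivative is (c z + d)⁻², its real Jacobian is the squared
modulus, and the map is injective off its pole with image of full measure. -/
theorem lintegral_homography (g : PSL(2, ℂ)) (f : ℂ → ℝ≥0∞) :
    ∫⁻ z, ‖(denomSq g z)⁻¹‖ₑ ^ 2 * f (homography g z) = ∫⁻ z, f z := by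
  have hae := ae_denomSq_ne_zero g
  induction g using QuotientGroup.induction_on with | H A
  simp only [denomSq_mk, homography_mk] at *
  have hA := SL_det_eq A
  set a := A 0 0
  set b := A 0 1
  set c := A 1 0
  set d := A 1 1
  set s : Set ℂ := {z | c * z + d ≠ 0} with hs
  have hsm : MeasurableSet s := by
    have : IsOpen s := isOpen_ne_fun (by fun_prop) continuous_const
    exact this.measurableSet
  have hder : ∀ z ∈ s, HasFDerivWithinAt (fun z => (a * z + b) / (c * z + d))
      (((c * z + d) ^ 2)⁻¹ • (1 : ℂ →L[ℝ] ℂ)) s z := by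
    intro z hz
    have h1 : HasDerivAt (fun z : ℂ => a * z + b) a z := by
      simpa using ((hasDerivAt_id z).const_mul a).add_const b
    have h2 : HasDerivAt (fun z : ℂ => c * z + d) c z := by
      simpa using ((hasDerivAt_id z).const_mul c).add_const d
    have h3 := h1.div h2 hz
    have e : (a * (c * z + d) - (a * z + b) * c) / (c * z + d) ^ 2 = ((c * z + d) ^ 2)⁻¹ := by
      rw [div_eq_mul_inv]
      have : a * (c * z + d) - (a * z + b) * c = 1 := by linear_combination hA
      rw [this, one_mul]
    rw [e] at h3
    exact h3.complexToReal_fderiv.hasFDerivWithinAt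
  have hinj : Set.InjOn (fun z => (a * z + b) / (c * z + d)) s := by
    intro z hz w hw h
    change c * z + d ≠ 0 at hz
    change c * w + d ≠ 0 at hw
    simp only at h
    rw [div_eq_div_iff hz hw] at h
    linear_combination h - (z - w) * hA
  have hdet : ∀ w : ℂ, ENNReal.ofReal |((w • (1 : ℂ →L[ℝ] ℂ)).det)| = ‖w‖ₑ ^ 2 := by
    intro w
    have h1 : (w • (1 : ℂ →L[ℝ] ℂ)).det = Complex.normSq w := by
      rw [← Algebra.norm_complex_apply, Algebra.norm_apply]
      rfl
    rw [h1, abs_of_nonneg (Complex.normSq_nonneg w), Complex.normSq_eq_norm_sq,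
      ENNReal.ofReal_pow (norm_nonneg w), ofReal_norm]
  have key := lintegral_image_eq_lintegral_abs_det_fderiv_mul volume hsm hder hinj f
  have himg : (fun z => (a * z + b) / (c * z + d)) '' s =ᵐ[volume] Set.univ := by
    rw [ae_eq_univ]
    refine measure_mono_null (t := {w : ℂ | (-c) * w + a = 0}) ?_
      (measure_setOf_mul_add_eq_zero ?_)
    · intro w hw
      by_contra hne
      have hne' : -c * w + a ≠ 0 := hne
      refine hw ⟨(d * w - b) / (-c * w + a), ?_, ?_⟩
      · change c * ((d * w - b) / (-c * w + a)) + d ≠ 0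
        have : c * ((d * w - b) / (-c * w + a)) + d = 1 / (-c * w + a) := by
          rw [eq_div_iff hne', add_mul, mul_assoc, div_mul_cancel₀ _ hne']
          linear_combination hA
        rw [this]
        exact one_div_ne_zero hne'
      · have h1 : c * ((d * w - b) / (-c * w + a)) + d = 1 / (-c * w + a) := by
          rw [eq_div_iff hne', add_mul, mul_assoc, div_mul_cancel₀ _ hne']
          linear_combination hA
        simp only [h1]
        rw [div_div_eq_mul_div, div_one, add_mul, mul_assoc, div_mul_cancel₀ _ hne']
        linear_combination w * hA
    · by_contra! h
      rw [neg_eq_zero] at h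
      rw [h.1, h.2] at hA
      simp at hA
  have hs_ae : s =ᵐ[volume] Set.univ := by
    rw [ae_eq_univ]
    refine measure_mono_null ?_ (ae_iff.1 hae)
    intro z hz
    simpa [hs] using hz
  rw [setLIntegral_congr himg, setLIntegral_congr hs_ae, setLIntegral_univ, setLIntegral_univ] at key
  rw [key]
  simp only [hdet]

theorem ae_homography_notMem (g : PSL(2, ℂ)) {Z : Set ℂ} (hZ : MeasurableSet Z)
    (h0 : volume Z = 0) : ∀ᵐ z : ℂ, homography g z ∉ Z := by
  have h1 := lintegral_homography g (Z.indicator 1)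
  rw [lintegral_indicator_one hZ, h0] at h1
  have hmeas : Measurable fun z : ℂ =>
      ‖(denomSq g z)⁻¹‖ₑ ^ 2 * Z.indicator (1 : ℂ → ℝ≥0∞) (homography g z) := by
    have hd : Measurable (denomSq g) := by unfold denomSq; fun_prop
    have hh : Measurable (homography g) := by unfold homography; fun_prop
    exact (hd.inv.enorm.pow_const 2).mul ((measurable_one.indicator hZ).comp hh)
  rw [lintegral_eq_zero_iff hmeas] at h1
  filter_upwards [h1, ae_denomSq_ne_zero g] with z hz hd hmem
  simp [hmem, hd] at hz

/-! ### Forms in the affine coordinate -/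

namespace OneForm

theorem form_smul_apply (Φ : OneForm) {c : ℂ} (hc : c ≠ 0) (v w : Fin 2 → ℂ) :
    Φ.form (c • v) (c • w) = Φ.form v w := Φ.2.2 c hc v w

theorem form_self (Φ : OneForm) (v : Fin 2 → ℂ) : Φ.form v v = 0 := Φ.2.1 v

theorem form_zero (Φ : OneForm) : Φ.form 0 = 0 := by
  ext1 w
  have h := Φ.form_smul_apply (c := 2) two_ne_zero 0 w
  rw [smul_zero, map_smul, smul_eq_mul] at h
  simpa using (show (Φ.form 0) w = 0 by linear_combination h)

theorem wedge_mul_form (Φ : OneForm) (v w x : Fin 2 → ℂ) :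
    wedge x v * Φ.form v w = wedge w v * Φ.form v x := by
  have e : wedge x v • w = wedge w v • x + wedge x w • v := by
    ext i
    fin_cases i <;> simp [wedge] <;> ring
  have := congrArg (Φ.form v) e
  simpa [form_self] using this

/-- The linear forms on ℂ² killing v ≠ 0 form a line. Since `x` and `l` do not depend on Φ, the
integral of a field of forms reduces to a scalar one. -/
theorem exists_form_eq (v : Fin 2 → ℂ) : ∃ (x : Fin 2 → ℂ) (l : (Fin 2 → ℂ) →L[ℂ] ℂ),
    ∀ Φ : OneForm, Φ.form v = Φ.form v x • l := by
  by_cases hv : v = 0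
  · subst hv
    exact ⟨0, 0, fun Φ => by ext1 w; simp [form_zero]⟩
  · obtain ⟨x, hx⟩ : ∃ x, wedge x v ≠ 0 := by
      by_contra! h
      apply hv
      have h0 := h ![1, 0]
      have h1 := h ![0, 1]
      simp [wedge] at h0 h1
      ext i
      fin_cases i <;> simp [h0, h1]
    refine ⟨x, LinearMap.toContinuousLinearMap
      { toFun := fun w => (wedge x v)⁻¹ * wedge w v
        map_add' := fun w w' => by simp [wedge]; ring
        map_smul' := fun c w => by simp [wedge]; ring }, fun Φ => ?_⟩
    ext1 w
    have h := Φ.wedge_mul_form v w x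
    change Φ.form v w = Φ.form v x * ((wedge x v)⁻¹ * wedge w v)
    field_simp
    linear_combination h

theorem form_affine (Φ : OneForm) (z : ℂ) (w : Fin 2 → ℂ) :
    Φ.form ![z, 1] w = Φ.coeff z * wedge w ![z, 1] := by
  have := Φ.wedge_mul_form ![z, 1] w ![1, 0]
  simp only [wedge, coeff] at *
  simp at *
  linear_combination this

theorem pullback_mk_form (A : SL(2, ℂ)) (Φ : OneForm) (v w : Fin 2 → ℂ) :
    (pullback (QuotientGroup.mk A) Φ).form v w =
      Φ.form ((A : Matrix (Fin 2) (Fin 2) ℂ) *ᵥ v) ((A : Matrix (Fin 2) (Fin 2) ℂ) *ᵥ w) := rfl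

theorem coeff_pullback (g : PSL(2, ℂ)) (Φ : OneForm) {z : ℂ} (hz : denomSq g z ≠ 0) :
    (pullback g Φ).coeff z = (denomSq g z)⁻¹ * Φ.coeff (homography g z) := by
  induction g using QuotientGroup.induction_on with | H A
  rw [denomSq_mk] at hz
  rw [denomSq_mk, homography_mk]
  have hd : A 1 0 * z + A 1 1 ≠ 0 := fun h => hz (by rw [h]; simp)
  have hA := SL_det_eq A
  unfold coeff
  rw [pullback_mk_form]
  have e2 : (A : Matrix (Fin 2) (Fin 2) ℂ) *ᵥ ![1, 0] =
      (A 1 0 * z + A 1 1) • ((A 1 0 * z + A 1 1)⁻¹ • ![A 0 0, A 1 0]) := by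
    rw [smul_inv_smul₀ hd]
    ext i
    fin_cases i <;> simp [Matrix.mulVec, dotProduct]
  rw [SL_mulVec_affine A hd, e2, form_smul_apply _ hd, map_smul, form_affine]
  unfold coeff
  have e3 : wedge ![A 0 0, A 1 0] ![(A 0 0 * z + A 0 1) / (A 1 0 * z + A 1 1), 1] =
      (A 1 0 * z + A 1 1)⁻¹ := by
    simp [wedge]
    field_simp
    linear_combination hA
  rw [e3, smul_eq_mul, pow_two, mul_inv]
  ring

theorem pullback_mul_form (g h : PSL(2, ℂ)) (Φ : OneForm) :
    pullback (g * h) Φ = pullback h (pullback g Φ) := by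
  induction g using QuotientGroup.induction_on with | H A
  induction h using QuotientGroup.induction_on with | H B
  refine Subtype.ext (funext fun v => ContinuousLinearMap.ext fun w => ?_)
  change (pullback (QuotientGroup.mk (A * B)) Φ).form v w =
    (pullback (QuotientGroup.mk B) (pullback (QuotientGroup.mk A) Φ)).form v w
  rw [pullback_mk_form, pullback_mk_form, pullback_mk_form, Matrix.mulVec_mulVec,
    Matrix.mulVec_mulVec, Matrix.SpecialLinearGroup.coe_mul]

/-- No integrability is needed: all the forms at v are multiples of one fixed form, and constants
factor out of a Bochner integral in every case. -/
theorem transfer_form_apply [MeasurableSpace PSL(2, ℂ)] (ν : Measure PSL(2, ℂ)) (Φ : OneForm)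
    (v w : Fin 2 → ℂ) : (transfer ν Φ).form v w = ∫ g, (pullback g Φ).form v w ∂ν := by
  obtain ⟨x, l, hl⟩ := exists_form_eq v
  change (∫ g, (pullback g Φ).form v ∂ν) w = _
  have h1 : ∀ g, (pullback g Φ).form v = (pullback g Φ).form v x • l := fun g => hl _
  have h2 : ∀ g, (pullback g Φ).form v w = (pullback g Φ).form v x * l w := fun g => by
    conv_lhs => rw [h1 g]
    simp
  simp only [h2]
  rw [integral_congr_ae (Filter.Eventually.of_forall h1), integral_smul_const,
    integral_mul_const]
  simp

theorem transfer_coeff [MeasurableSpace PSL(2, ℂ)] (ν : Measure PSL(2, ℂ)) (Φ : OneForm) (z : ℂ) :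
    (transfer ν Φ).coeff z = ∫ g, (pullback g Φ).coeff z ∂ν :=
  transfer_form_apply ν Φ _ _

/-- The integral of `|u|²` over a part of `ℙ¹`, for a form `u dz`. -/
def mass (Φ : OneForm) (B : Set (Fin 2 → ℂ)) : ℝ≥0∞ :=
  ∫⁻ z in {z : ℂ | ![z, 1] ∈ B}, ‖Φ.coeff z‖ₑ ^ 2

end OneForm

theorem measurable_affine : Measurable fun z : ℂ => (![z, 1] : Fin 2 → ℂ) :=
  Continuous.measurable (by fun_prop)

namespace OneForm

theorem mass_pullback (A : SL(2, ℂ)) (Φ : OneForm) {B : Set (Fin 2 → ℂ)}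
    (hB : IsMeasurableCone B) :
    (pullback (QuotientGroup.mk A) Φ).mass (matPreimage A B) = Φ.mass B := by
  have hm1 : MeasurableSet {z : ℂ | ![z, 1] ∈ B} := measurable_affine hB.1
  have hm2 : MeasurableSet {z : ℂ | ![z, 1] ∈ matPreimage A B} :=
    measurable_affine (hB.preimage A).1
  unfold mass
  rw [← lintegral_indicator hm1, ← lintegral_indicator hm2, 
    ← lintegral_homography (QuotientGroup.mk A)
      ({z : ℂ | ![z, 1] ∈ B}.indicator fun z => ‖Φ.coeff z‖ₑ ^ 2)]
  refine lintegral_congr_ae ?_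
  filter_upwards [ae_denomSq_ne_zero (QuotientGroup.mk A)] with z hz
  have hd : A 1 0 * z + A 1 1 ≠ 0 := fun h => hz (by rw [denomSq_mk, h]; simp)
  have hiff : ![z, 1] ∈ matPreimage A B ↔ ![homography (QuotientGroup.mk A) z, 1] ∈ B := by
    change (A : Matrix (Fin 2) (Fin 2) ℂ) *ᵥ ![z, 1] ∈ B ↔ _
    rw [SL_mulVec_affine A hd, hB.2 _ hd, homography_mk]
  by_cases hmem : ![homography (QuotientGroup.mk A) z, 1] ∈ B
  · rw [Set.indicator_of_mem (show z ∈ {z : ℂ | ![z, 1] ∈ matPreimage A B} from hiff.2 hmem),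
      Set.indicator_of_mem (show homography (QuotientGroup.mk A) z ∈ {z : ℂ | ![z, 1] ∈ B} from hmem),
      coeff_pullback _ _ hz, enorm_mul, mul_pow]
  · rw [Set.indicator_of_notMem (show z ∉ {z : ℂ | ![z, 1] ∈ matPreimage A B} from
        fun h => hmem (hiff.1 h)),
      Set.indicator_of_notMem (show homography (QuotientGroup.mk A) z ∉ {z : ℂ | ![z, 1] ∈ B} from hmem),
      mul_zero]

theorem lintegral_pullback (g : PSL(2, ℂ)) (Φ : OneForm) :
    ∫⁻ z, ‖(pullback g Φ).coeff z‖ₑ ^ 2 = ∫⁻ z, ‖Φ.coeff z‖ₑ ^ 2 := by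
  rw [← lintegral_homography g fun z => ‖Φ.coeff z‖ₑ ^ 2]
  refine lintegral_congr_ae ?_
  filter_upwards [ae_denomSq_ne_zero g] with z hz
  rw [coeff_pullback _ _ hz, enorm_mul, mul_pow]

theorem aestronglyMeasurable_pullback (g : PSL(2, ℂ)) {Φ : OneForm}
    (hΦ : AEStronglyMeasurable Φ.coeff) : AEStronglyMeasurable (pullback g Φ).coeff := by
  obtain ⟨u, hu, hae⟩ := hΦ
  obtain ⟨Z, hsub, hZ, hZ0⟩ := exists_measurable_superset_of_null (ae_iff.1 hae)
  have hd : Measurable (denomSq g) := by unfold denomSq; fun_prop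
  have hh : Measurable (homography g) := by unfold homography; fun_prop
  refine ⟨fun z => (denomSq g z)⁻¹ * u (homography g z),
    (hd.inv.mul (hu.measurable.comp hh)).stronglyMeasurable, ?_⟩
  filter_upwards [ae_denomSq_ne_zero g, ae_homography_notMem g hZ hZ0] with z hz hn
  rw [coeff_pullback _ _ hz]
  congr 1
  by_contra hne
  exact hn (hsub hne)

variable [MeasurableSpace PSL(2, ℂ)] [BorelSpace PSL(2, ℂ)]

/-- The coefficient is measurable only off a null set Z. Each homography pulls Z back to a null set,
so by Fubini the exceptional pairs are negligible. -/
theorem aestronglyMeasurable_prod (ν : Measure PSL(2, ℂ)) [IsProbabilityMeasure ν] {Φ : OneForm}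
    (hΦ : AEStronglyMeasurable Φ.coeff) :
    AEStronglyMeasurable (fun p : PSL(2, ℂ) × ℂ => (pullback p.1 Φ).coeff p.2)
      (ν.prod volume) := by
  obtain ⟨u, hu, hae⟩ := hΦ
  obtain ⟨Z, hsub, hZ, hZ0⟩ := exists_measurable_superset_of_null (ae_iff.1 hae)
  refine ⟨fun p => (denomSq p.1 p.2)⁻¹ * u (homography p.1 p.2),
    (measurable_denomSq.inv.mul (hu.measurable.comp measurable_homography)).stronglyMeasurable, ?_⟩
  have hset : MeasurableSet {p : PSL(2, ℂ) × ℂ | denomSq p.1 p.2 ≠ 0 ∧ homography p.1 p.2 ∉ Z} :=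
    ((measurable_denomSq (measurableSet_singleton 0)).compl).inter (measurable_homography hZ).compl
  have h : ∀ᵐ p : PSL(2, ℂ) × ℂ ∂(ν.prod volume),
      p ∈ {p : PSL(2, ℂ) × ℂ | denomSq p.1 p.2 ≠ 0 ∧ homography p.1 p.2 ∉ Z} := by
    rw [Measure.ae_prod_mem_iff_ae_ae_mem hset]
    refine Filter.Eventually.of_forall fun g => ?_
    filter_upwards [ae_denomSq_ne_zero g, ae_homography_notMem g hZ hZ0] with z hz hn
    exact ⟨hz, hn⟩
  filter_upwards [h] with p hp
  rw [coeff_pullback _ _ hp.1]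
  congr 1
  by_contra hne
  exact hp.2 (hsub hne)

end OneForm

/-! ### The transfer operator -/

/-- The variance formula, kept in `ℝ≥0∞` so that it can be integrated over z by Tonelli. -/
theorem lintegral_variance {α : Type*} [MeasurableSpace α] (ν : Measure α)
    [IsProbabilityMeasure ν] {X : α → ℂ} (hX : MemLp X 2 ν) :
    ∫⁻ a, ‖X a - ∫ b, X b ∂ν‖ₑ ^ 2 ∂ν + ‖∫ b, X b ∂ν‖ₑ ^ 2 = ∫⁻ a, ‖X a‖ₑ ^ 2 ∂ν := by
  set c := ∫ b, X b ∂ν with hc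
  have hconv : ∀ Y : α → ℂ, MemLp Y 2 ν →
      ∫⁻ a, ‖Y a‖ₑ ^ 2 ∂ν = ENNReal.ofReal (∫ a, ‖Y a‖ ^ 2 ∂ν) := by
    intro Y hY
    rw [ofReal_integral_eq_lintegral_ofReal ((memLp_two_iff_integrable_sq_norm hY.1).1 hY)
      (Filter.Eventually.of_forall fun a => sq_nonneg _)]
    refine lintegral_congr fun a => ?_
    rw [ENNReal.ofReal_pow (norm_nonneg _), ofReal_norm]
  have hXc : MemLp (fun a => X a - c) 2 ν := hX.sub (memLp_const c)
  have hX2 : Integrable (fun a => ‖X a‖ ^ 2) ν := (memLp_two_iff_integrable_sq_norm hX.1).1 hX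
  have hXi : Integrable X ν := hX.integrable (by norm_num)
  rw [hconv _ hX, hconv _ hXc, ← ofReal_norm, ← ENNReal.ofReal_pow (norm_nonneg _),
    ← ENNReal.ofReal_add (integral_nonneg fun a => sq_nonneg _) (sq_nonneg _)]
  congr 1
  have hre : ∀ a, ‖X a - c‖ ^ 2 = ‖X a‖ ^ 2 - 2 * (X a * (starRingEnd ℂ) c).re + ‖c‖ ^ 2 := by
    intro a
    simp only [← Complex.normSq_eq_norm_sq, Complex.normSq_sub]
    ring
  have hi1 : Integrable (fun a => X a * (starRingEnd ℂ) c) ν := hXi.mul_const _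
  have hi2 : Integrable (fun a => (X a * (starRingEnd ℂ) c).re) ν := hi1.re
  have hint : ∫ a, (X a * (starRingEnd ℂ) c).re ∂ν = ‖c‖ ^ 2 := by
    have h1 : ∫ a, (X a * (starRingEnd ℂ) c).re ∂ν = (∫ a, X a * (starRingEnd ℂ) c ∂ν).re :=
      integral_re hi1
    rw [h1, integral_mul_const, ← hc, Complex.mul_conj, Complex.normSq_eq_norm_sq,
      Complex.ofReal_re]
  have hi3 : Integrable (fun a => ‖X a‖ ^ 2 - 2 * (X a * (starRingEnd ℂ) c).re) ν :=
    hX2.sub (hi2.const_mul 2)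
  simp only [hre]
  rw [integral_add hi3 (integrable_const _),
    integral_sub hX2 (hi2.const_mul 2), integral_const_mul, hint]
  simp
  ring

theorem memLp_two_iff {α : Type*} [MeasurableSpace α] {ν : Measure α} {X : α → ℂ} :
    MemLp X 2 ν ↔ AEStronglyMeasurable X ν ∧ ∫⁻ a, ‖X a‖ₑ ^ 2 ∂ν < ∞ := by
  unfold MemLp
  rw [eLpNorm_lt_top_iff_lintegral_rpow_enorm_lt_top (by norm_num) (by norm_num)]
  simp

namespace OneForm

/-- The integral `∫ |u|²` for a form `u dz`. -/
def energy (Φ : OneForm) : ℝ≥0∞ := ∫⁻ z, ‖Φ.coeff z‖ₑ ^ 2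

theorem memL2_iff {Φ : OneForm} : Φ.MemL2 ↔ AEStronglyMeasurable Φ.coeff ∧ Φ.energy < ∞ := by
  rw [MemL2, areaMeasure, memLp_two_iff, lintegral_smul_measure, energy,
    aestronglyMeasurable_iff_aemeasurable, aestronglyMeasurable_iff_aemeasurable,
    aemeasurable_smul_measure_iff two_ne_zero, smul_eq_mul]
  refine and_congr_right fun _ => ⟨fun h => ?_, fun h => ENNReal.mul_lt_top (by norm_num) h⟩
  exact (le_mul_of_one_le_left zero_le one_le_two).trans_lt h

theorem pullback_add (g : PSL(2, ℂ)) (Φ Ψ : OneForm) :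
    pullback g (Φ + Ψ) = pullback g Φ + pullback g Ψ := by
  induction g using QuotientGroup.induction_on with | H A
  rfl

theorem pullback_smul (g : PSL(2, ℂ)) (c : ℂ) (Φ : OneForm) :
    pullback g (c • Φ) = c • pullback g Φ := by
  induction g using QuotientGroup.induction_on with | H A
  rfl

theorem coeff_add (Φ Ψ : OneForm) (z : ℂ) : (Φ + Ψ).coeff z = Φ.coeff z + Ψ.coeff z := rfl

theorem coeff_smul (c : ℂ) (Φ : OneForm) (z : ℂ) : (c • Φ).coeff z = c * Φ.coeff z := rfl

theorem transfer_smul_coeff [MeasurableSpace PSL(2, ℂ)] (ν : Measure PSL(2, ℂ)) (c : ℂ) (Φ : OneForm) :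
    (transfer ν (c • Φ)).coeff = (c • transfer ν Φ).coeff := by
  ext z
  rw [coeff_smul, transfer_coeff, transfer_coeff, ← integral_const_mul]
  simp only [pullback_smul, coeff_smul]

variable [MeasurableSpace PSL(2, ℂ)] [BorelSpace PSL(2, ℂ)]
  (ν : Measure PSL(2, ℂ)) [IsProbabilityMeasure ν]

theorem lintegral_lintegral_pullback {Φ : OneForm} (hΦ : AEStronglyMeasurable Φ.coeff) :
    ∫⁻ z, ∫⁻ g, ‖(pullback g Φ).coeff z‖ₑ ^ 2 ∂ν = Φ.energy := by
  rw [lintegral_lintegral_swap]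
  · simp only [lintegral_pullback]
    simp [energy]
  · exact ((aestronglyMeasurable_prod ν hΦ).prod_swap.enorm.pow_const 2)

theorem ae_memLp_pullback {Φ : OneForm} (hΦ : Φ.MemL2) :
    ∀ᵐ z : ℂ, MemLp (fun g => (pullback g Φ).coeff z) 2 ν := by
  rw [memL2_iff] at hΦ
  have h1 := lintegral_lintegral_pullback ν hΦ.1
  have hm := (aestronglyMeasurable_prod ν hΦ.1).prod_swap
  have h2 : AEMeasurable fun z => ∫⁻ g, ‖(pullback g Φ).coeff z‖ₑ ^ 2 ∂ν :=
    (hm.enorm.pow_const 2).lintegral_prod_right'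
  have h3 := ae_lt_top' h2 (by rw [h1]; exact hΦ.2.ne)
  filter_upwards [h3, hm.prodMk_left] with z hz hmz
  exact memLp_two_iff.2 ⟨hmz, hz⟩

theorem aestronglyMeasurable_transfer {Φ : OneForm} (hΦ : AEStronglyMeasurable Φ.coeff) :
    AEStronglyMeasurable (transfer ν Φ).coeff := by
  have : (transfer ν Φ).coeff = fun z => ∫ g, (pullback g Φ).coeff z ∂ν := by
    ext z
    rw [transfer_coeff]
  rw [this]
  exact (aestronglyMeasurable_prod ν hΦ).prod_swap.integral_prod_right'

theorem aemeasurable_defect {Φ Ψ : OneForm} (hΦ : AEStronglyMeasurable Φ.coeff)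
    (hΨ : AEStronglyMeasurable Ψ.coeff) :
    AEMeasurable (fun p : PSL(2, ℂ) × ℂ => ‖(pullback p.1 Φ).coeff p.2 - Ψ.coeff p.2‖ₑ ^ 2)
      (ν.prod volume) :=
  ((aestronglyMeasurable_prod ν hΦ).sub hΨ.comp_snd).enorm.pow_const 2

/-- At almost every z, apply the variance formula to g ↦ (g^*Φ)(z); integrating in z, the second
moment becomes the energy of Φ because every pull-back is isometric. -/
theorem lintegral_defect_add_energy {Φ : OneForm} (hΦ : Φ.MemL2) :
    ∫⁻ g, ∫⁻ z, ‖(pullback g Φ).coeff z - (transfer ν Φ).coeff z‖ₑ ^ 2 ∂volume ∂ν + (transfer ν Φ).energy =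
      Φ.energy := by
  have hm := (memL2_iff.1 hΦ).1
  have hT := aestronglyMeasurable_transfer ν hm
  rw [lintegral_lintegral_swap (aemeasurable_defect ν hm hT)]
  change _ + ∫⁻ z, ‖(transfer ν Φ).coeff z‖ₑ ^ 2 = _
  rw [
    ← lintegral_add_right' _ (hT.enorm.pow_const 2), ← lintegral_lintegral_pullback ν hm]
  refine lintegral_congr_ae ?_
  filter_upwards [ae_memLp_pullback ν hΦ] with z hz
  rw [← lintegral_variance ν hz, transfer_coeff]

theorem energy_transfer_le {Φ : OneForm} (hΦ : Φ.MemL2) : (transfer ν Φ).energy ≤ Φ.energy := by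
  rw [← lintegral_defect_add_energy ν hΦ]
  exact le_add_self

theorem memL2_transfer {Φ : OneForm} (hΦ : Φ.MemL2) : (transfer ν Φ).MemL2 :=
  memL2_iff.2 ⟨aestronglyMeasurable_transfer ν (memL2_iff.1 hΦ).1,
    (energy_transfer_le ν hΦ).trans_lt (memL2_iff.1 hΦ).2⟩

theorem ae_integrable_form {Φ : OneForm} (hΦ : Φ.MemL2) :
    ∀ᵐ z : ℂ, Integrable (fun g => (pullback g Φ).form ![z, 1]) ν := by
  filter_upwards [ae_memLp_pullback ν hΦ] with z hz
  have h1 : Integrable (fun g => (pullback g Φ).coeff z) ν := hz.integrable (by norm_num)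
  let l : (Fin 2 → ℂ) →L[ℂ] ℂ := LinearMap.toContinuousLinearMap
    { toFun := fun w => wedge w ![z, 1]
      map_add' := fun w w' => by simp [wedge]; ring
      map_smul' := fun c w => by simp [wedge]; ring }
  have h2 : (fun g => (pullback g Φ).form ![z, 1]) = fun g => (pullback g Φ).coeff z • l := by
    ext1 g
    ext1 w
    exact form_affine _ _ _
  rw [h2]
  exact h1.smul_const l

/-- The order is reversed because (g h)^* = h^* g^*. Fubini needs integrability, hence an equality
only almost everywhere. -/
theorem transfer_mconv_coeff (μ : Measure PSL(2, ℂ)) [IsProbabilityMeasure μ] {Φ : OneForm}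
    (hΦ : Φ.MemL2) :
    (transfer (μ.mconv ν) Φ).coeff =ᵐ[volume] (transfer ν (transfer μ Φ)).coeff := by
  have : IsProbabilityMeasure (μ.mconv ν) := by
    unfold Measure.mconv
    exact Measure.isProbabilityMeasure_map measurable_mul.aemeasurable
  filter_upwards [ae_memLp_pullback (μ.mconv ν) hΦ] with z hz
  have hint : Integrable (fun g => (pullback g Φ).coeff z) (μ.mconv ν) := hz.integrable (by norm_num)
  rw [transfer_coeff, transfer_coeff]
  unfold Measure.mconv at hint ⊢
  rw [integral_map measurable_mul.aemeasurable hint.aestronglyMeasurable]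
  have hint2 : Integrable (fun x : PSL(2, ℂ) × PSL(2, ℂ) => (pullback (x.1 * x.2) Φ).coeff z)
      (μ.prod ν) := hint.comp_measurable (measurable_mul (M := PSL(2, ℂ)))
  rw [integral_prod_symm _ hint2]
  refine integral_congr_ae (Filter.Eventually.of_forall fun h => ?_)
  simp only
  induction h using QuotientGroup.induction_on with | H B
  change _ = (transfer μ Φ).form _ _
  rw [transfer_form_apply]
  refine integral_congr_ae (Filter.Eventually.of_forall fun g => ?_)
  simp only [coeff]
  rw [pullback_mul_form, pullback_mk_form]
  rfl

theorem transfer_add_coeff {Φ Ψ : OneForm} (hΦ : Φ.MemL2) (hΨ : Ψ.MemL2) :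
    (transfer ν (Φ + Ψ)).coeff =ᵐ[volume] (transfer ν Φ + transfer ν Ψ).coeff := by
  filter_upwards [ae_memLp_pullback ν hΦ, ae_memLp_pullback ν hΨ] with z h1 h2
  rw [coeff_add, transfer_coeff, transfer_coeff, transfer_coeff,
    ← integral_add (h1.integrable (by norm_num)) (h2.integrable (by norm_num))]
  simp only [pullback_add, coeff_add]

end OneForm

/-! ### The operator on classes of forms -/

theorem L2Form.mk_eq_of_ae {Φ Ψ : OneForm} (hΦ : Φ.MemL2) (hΨ : Ψ.MemL2)
    (h : Φ.coeff =ᵐ[volume] Ψ.coeff) : L2Form.mk Φ hΦ = L2Form.mk Ψ hΨ := by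
  have h' : Φ.coeff =ᵐ[areaMeasure] Ψ.coeff := Measure.ae_smul_measure h 2
  refine SeparationQuotient.mk_eq_mk.2 (Metric.inseparable_iff.2 ?_)
  change dist (PreL2Form.coeffLp (⟨Φ, hΦ⟩ : PreL2Form)) (PreL2Form.coeffLp (⟨Ψ, hΨ⟩ : PreL2Form)) = 0
  have e : PreL2Form.coeffLp (⟨Φ, hΦ⟩ : PreL2Form) = PreL2Form.coeffLp (⟨Ψ, hΨ⟩ : PreL2Form) :=
    (MemLp.toLp_eq_toLp_iff hΦ hΨ).2 h'
  rw [e, dist_self]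

theorem L2Form.norm_mk (Φ : OneForm) (h : Φ.MemL2) :
    ‖L2Form.mk Φ h‖ = Real.sqrt (2 * Φ.energy).toReal := by
  change ‖PreL2Form.coeffLp (⟨Φ, h⟩ : PreL2Form)‖ = _
  refine (Lp.norm_toLp Φ.coeff (show MemLp Φ.coeff 2 areaMeasure from h)).trans ?_
  rw [eLpNorm_eq_lintegral_rpow_enorm_toReal (by norm_num) (by norm_num),
    Real.sqrt_eq_rpow, ENNReal.toReal_rpow, areaMeasure, lintegral_smul_measure]
  simp [OneForm.energy]

section TransferOperator

variable [MeasurableSpace PSL(2, ℂ)] [BorelSpace PSL(2, ℂ)]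

theorem L2Form.norm_mk_transfer_le (ν : Measure PSL(2, ℂ)) [IsProbabilityMeasure ν] {r : ℝ}
    (hr : 0 ≤ r) (Φ : OneForm) (hΦ : Φ.MemL2)
    (h : (Φ.transfer ν).energy ≤ ENNReal.ofReal (r ^ 2) * Φ.energy) :
    ‖L2Form.mk (Φ.transfer ν) (OneForm.memL2_transfer ν hΦ)‖ ≤ r * ‖L2Form.mk Φ hΦ‖ := by
  rw [norm_mk, norm_mk]
  have hfin := (OneForm.memL2_iff.1 hΦ).2.ne
  have h1 : (2 * (Φ.transfer ν).energy).toReal ≤ r ^ 2 * (2 * Φ.energy).toReal := by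
    have := ENNReal.toReal_mono (by finiteness) h
    rw [ENNReal.toReal_mul, ENNReal.toReal_ofReal (sq_nonneg r)] at this
    rw [ENNReal.toReal_mul, ENNReal.toReal_mul]
    nlinarith [ENNReal.toReal_nonneg (a := 2)]
  calc _ ≤ Real.sqrt (r ^ 2 * (2 * Φ.energy).toReal) := Real.sqrt_le_sqrt h1
    _ = _ := by rw [Real.sqrt_mul (sq_nonneg r), Real.sqrt_sq hr]

/-- The operator `f_ν^*` is well defined, and it is bounded by `r` as soon as the energy of every
form is multiplied by at most `r²`. -/
theorem exists_isTransferOperator (ν : Measure PSL(2, ℂ)) [IsProbabilityMeasure ν] {r : ℝ}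
    (hr : 0 ≤ r) (h : ∀ Φ : OneForm, Φ.MemL2 →
      (Φ.transfer ν).energy ≤ ENNReal.ofReal (r ^ 2) * Φ.energy) :
    ∃ T : L2Form →L[ℂ] L2Form, IsTransferOperator ν T ∧ ‖T‖ ≤ r := by
  let T₀ : PreL2Form →ₗ[ℂ] L2Form :=
    { toFun := fun Φ => L2Form.mk (OneForm.transfer ν Φ.1) (OneForm.memL2_transfer ν Φ.2)
      map_add' := fun Φ Ψ => by
        have h1 := OneForm.memL2_transfer ν Φ.2
        have h2 := OneForm.memL2_transfer ν Ψ.2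
        exact L2Form.mk_eq_of_ae (OneForm.memL2_transfer ν (Φ + Ψ).2)
          (l2FormSubmodule.add_mem h1 h2) (OneForm.transfer_add_coeff ν Φ.2 Ψ.2)
      map_smul' := fun c Φ => by
        have h1 := OneForm.memL2_transfer ν Φ.2
        exact L2Form.mk_eq_of_ae (OneForm.memL2_transfer ν (c • Φ).2)
          (l2FormSubmodule.smul_mem c h1)
          (Filter.EventuallyEq.of_eq (OneForm.transfer_smul_coeff ν c Φ.1)) }
  have hbound : ∀ Φ : PreL2Form, ‖T₀ Φ‖ ≤ r * ‖Φ‖ := fun Φ =>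
    L2Form.norm_mk_transfer_le ν hr Φ.1 Φ.2 (h Φ.1 Φ.2)
  let T₁ : PreL2Form →L[ℂ] L2Form := T₀.mkContinuous r hbound
  let T : L2Form →L[ℂ] L2Form := SeparationQuotient.liftCLM T₁
    fun x y hxy => (hxy.map T₁.continuous).eq
  refine ⟨T, fun Φ hΦ => ⟨OneForm.ae_integrable_form ν hΦ, OneForm.memL2_transfer ν hΦ, rfl⟩, ?_⟩
  refine ContinuousLinearMap.opNorm_le_bound _ hr fun x => ?_
  obtain ⟨Φ, rfl⟩ := SeparationQuotient.surjective_mk x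
  exact hbound Φ

end TransferOperator

/-! ### Almost invariant sequences of forms -/

/-- Young's inequality with a free parameter: once the difference has tended to 0, t is sent to 0.
-/
theorem enorm_sq_le_of_pos {t : ℝ} (ht : 0 < t) (x y : ℂ) :
    ‖x‖ₑ ^ 2 ≤ ENNReal.ofReal (1 + t) * ‖y‖ₑ ^ 2 + ENNReal.ofReal (1 + t⁻¹) * ‖x - y‖ₑ ^ 2 := by
  have h1 : ‖x‖ ≤ ‖y‖ + ‖x - y‖ := by
    simpa using norm_add_le y (x - y)
  have h2 : ‖x‖ ^ 2 ≤ (1 + t) * ‖y‖ ^ 2 + (1 + t⁻¹) * ‖x - y‖ ^ 2 := by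
    have h3 : ‖x‖ ^ 2 ≤ (‖y‖ + ‖x - y‖) ^ 2 := pow_le_pow_left₀ (norm_nonneg _) h1 2
    have h4 : 0 ≤ t⁻¹ * (t * ‖y‖ - ‖x - y‖) ^ 2 := by positivity
    have h5 : t⁻¹ * (t * ‖y‖ - ‖x - y‖) ^ 2 =
        t * ‖y‖ ^ 2 - 2 * ‖y‖ * ‖x - y‖ + t⁻¹ * ‖x - y‖ ^ 2 := by
      field_simp
      ring
    nlinarith
  simp only [← ofReal_norm, ← ENNReal.ofReal_pow (norm_nonneg _)]
  rw [← ENNReal.ofReal_mul (by positivity), ← ENNReal.ofReal_mul (by positivity),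
    ← ENNReal.ofReal_add (by positivity) (by positivity)]
  exact ENNReal.ofReal_le_ofReal h2

namespace OneForm

theorem mass_le_energy (Φ : OneForm) (B : Set (Fin 2 → ℂ)) : Φ.mass B ≤ Φ.energy :=
  setLIntegral_le_lintegral _ _

theorem mass_univ (Φ : OneForm) : Φ.mass Set.univ = Φ.energy := by
  simp [mass, energy]

theorem mass_mono (Φ : OneForm) {B B' : Set (Fin 2 → ℂ)} (h : B ⊆ B') : Φ.mass B ≤ Φ.mass B' :=
  lintegral_mono_set fun _ hz => h hz

theorem mass_union (Φ : OneForm) {B B' : Set (Fin 2 → ℂ)} (hB' : IsMeasurableCone B')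
    (h : B ∩ B' ⊆ {0}) : Φ.mass (B ∪ B') = Φ.mass B + Φ.mass B' := by
  unfold mass
  have hm : MeasurableSet {z : ℂ | ![z, 1] ∈ B'} := measurable_affine hB'.1
  rw [← lintegral_union hm]
  · rfl
  · rw [Set.disjoint_left]
    intro z hz hz'
    have := congrFun (h ⟨hz, hz'⟩) 1
    simp at this

theorem mass_le_of_pos {Φ Ψ : OneForm} (hΨ : AEStronglyMeasurable Ψ.coeff) {t : ℝ} (ht : 0 < t)
    (B : Set (Fin 2 → ℂ)) : Φ.mass B ≤ ENNReal.ofReal (1 + t) * Ψ.mass B +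
      ENNReal.ofReal (1 + t⁻¹) * ∫⁻ z, ‖Φ.coeff z - Ψ.coeff z‖ₑ ^ 2 := by
  calc Φ.mass B ≤ ∫⁻ z in {z : ℂ | ![z, 1] ∈ B}, (ENNReal.ofReal (1 + t) * ‖Ψ.coeff z‖ₑ ^ 2 +
        ENNReal.ofReal (1 + t⁻¹) * ‖Φ.coeff z - Ψ.coeff z‖ₑ ^ 2) :=
        lintegral_mono fun z => enorm_sq_le_of_pos ht _ _
    _ = ENNReal.ofReal (1 + t) * Ψ.mass B + ENNReal.ofReal (1 + t⁻¹) *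
        ∫⁻ z in {z : ℂ | ![z, 1] ∈ B}, ‖Φ.coeff z - Ψ.coeff z‖ₑ ^ 2 := by
        rw [lintegral_add_left' ((hΨ.restrict.enorm.pow_const 2).const_mul _),
          lintegral_const_mul' _ _ ENNReal.ofReal_ne_top,
          lintegral_const_mul' _ _ ENNReal.ofReal_ne_top, mass]
    _ ≤ _ := by
        exact add_le_add_right (mul_le_mul_right (setLIntegral_le_lintegral _ _) _) _

end OneForm

theorem exists_tendsto_hyperfilter (f : ℕ → ℝ) (h0 : ∀ n, 0 ≤ f n) (h1 : ∀ n, f n ≤ 1) :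
    ∃ x, Filter.Tendsto f (Filter.hyperfilter ℕ) (nhds x) := by
  have h : ((Filter.hyperfilter ℕ).map f : Filter ℝ) ≤ Filter.principal (Set.Icc 0 1) := by
    rw [Filter.le_principal_iff]
    exact Filter.mem_map.2 (Filter.univ_mem' fun n => ⟨h0 n, h1 n⟩)
  obtain ⟨x, -, hx⟩ := (isCompact_Icc (a := (0 : ℝ)) (b := 1)).ultrafilter_le_nhds _ h
  exact ⟨x, hx⟩

open Filter Topology in
/-- If forms `φ n N` of energy close to `1` satisfy `g^*(φ n N) - φ n (N + 1) → 0` for all `g ∈ S`,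
then `S` is elementary. -/
theorem isElementary_of_almost_invariant {S : Set PSL(2, ℂ)} (φ : ℕ → ℕ → OneForm)
    (hφ : ∀ n N, AEStronglyMeasurable (φ n N).coeff) (h1 : ∀ n N, (φ n N).energy ≤ 1)
    (hlim : ∀ N, Tendsto (fun n => (φ n N).energy) atTop (𝓝 1))
    (hS : ∀ g ∈ S, ∀ N, Tendsto (fun n => ∫⁻ z,
      ‖(OneForm.pullback g (φ n N)).coeff z - (φ n (N + 1)).coeff z‖ₑ ^ 2) atTop (𝓝 0)) :
    IsElementary S := by
  -- One ultrafilter gives limits for all N and all sets at once. Finite additivity survives in the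
  -- limit; countable additivity may not, and is not needed.
  set U : Filter ℕ := (hyperfilter ℕ : Filter ℕ) with hU
  have hUle : U ≤ atTop := Nat.hyperfilter_le_atTop
  have : U.NeBot := by rw [hU]; infer_instance
  have hle : ∀ n N B, (φ n N).mass B ≤ 1 := fun n N B => (OneForm.mass_le_energy _ B).trans (h1 n N)
  have hne : ∀ n N B, (φ n N).mass B ≠ ∞ := fun n N B => ne_top_of_le_ne_top ENNReal.one_ne_top (hle n N B)
  have hle' : ∀ n N B, ((φ n N).mass B).toReal ≤ 1 := fun n N B => by
    simpa using ENNReal.toReal_mono ENNReal.one_ne_top (hle n N B)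
  have hex : ∀ N B, ∃ x, Tendsto (fun n => ((φ n N).mass B).toReal) U (𝓝 x) := fun N B =>
    exists_tendsto_hyperfilter _ (fun n => ENNReal.toReal_nonneg) fun n => hle' n N B
  choose M hM using hex
  refine isElementary_of_coneMeans M (fun N => ⟨?_, ?_, ?_, ?_⟩) ?_
  · intro B _
    exact ge_of_tendsto' (hM N B) fun n => ENNReal.toReal_nonneg
  · refine tendsto_nhds_unique (hM N Set.univ) ?_
    simp only [OneForm.mass_univ]
    have := (ENNReal.tendsto_toReal ENNReal.one_ne_top).comp (hlim N)
    exact this.mono_left hUle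
  · intro B B' _ _ hBB'
    exact le_of_tendsto_of_tendsto' (hM N B) (hM N B') fun n =>
      ENNReal.toReal_mono (hne n N B') (OneForm.mass_mono _ hBB')
  · intro B B' _ hB' hBB'
    refine tendsto_nhds_unique (hM N (B ∪ B')) ?_
    refine ((hM N B).add (hM N B')).congr fun n => ?_
    rw [OneForm.mass_union _ hB' hBB', ENNReal.toReal_add (hne n N B) (hne n N B')]
  · intro A hA N B hB
    set D : ℕ → ℝ≥0∞ := fun n => ∫⁻ z,
      ‖(OneForm.pullback (QuotientGroup.mk A) (φ n N)).coeff z - (φ n (N + 1)).coeff z‖ₑ ^ 2 with hD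
    have hD0 : Tendsto D U (𝓝 0) := (hS _ hA N).mono_left hUle
    have hDr : Tendsto (fun n => (D n).toReal) U (𝓝 0) := by
      have := (ENNReal.tendsto_toReal ENNReal.zero_ne_top).comp hD0
      exact this
    have hDfin : ∀ᶠ n in U, D n < ∞ := hD0.eventually (gt_mem_nhds ENNReal.zero_lt_top)
    -- The limit in n is taken at fixed t, which kills the term in `D`; only then does t tend to 0.
    -- The two masses are compared this way in both directions.
    have key : ∀ (x y : ℕ → ℝ≥0∞) (a b : ℝ), (∀ n, x n ≠ ∞) → (∀ n, y n ≠ ∞) →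
        Tendsto (fun n => (x n).toReal) U (𝓝 a) → Tendsto (fun n => (y n).toReal) U (𝓝 b) →
        (∀ t : ℝ, 0 < t → ∀ n, x n ≤ ENNReal.ofReal (1 + t) * y n + ENNReal.ofReal (1 + t⁻¹) * D n) →
        a ≤ b := by
      intro x y a b hx hy hxa hyb hxy
      have hb : ∀ t : ℝ, 0 < t → a ≤ (1 + t) * b := by
        intro t ht
        have hr := (hyb.const_mul (1 + t)).add (hDr.const_mul (1 + t⁻¹))
        rw [mul_zero, add_zero] at hr
        refine le_of_tendsto_of_tendsto hxa hr ?_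
        filter_upwards [hDfin] with n hn
        have h1 := ENNReal.toReal_mono (by finiteness [hy n, hn.ne]) (hxy t ht n)
        rw [ENNReal.toReal_add (by finiteness [hy n]) (by finiteness [hn.ne]), ENNReal.toReal_mul,
          ENNReal.toReal_mul, ENNReal.toReal_ofReal (by positivity),
          ENNReal.toReal_ofReal (by positivity)] at h1
        exact h1
      have hc : Tendsto (fun t : ℝ => (1 + t) * b) (𝓝[>] 0) (𝓝 ((1 + 0) * b)) :=
        ((continuous_const.add continuous_id).mul continuous_const).continuousWithinAt.tendsto
      rw [add_zero, one_mul] at hc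
      exact ge_of_tendsto hc (eventually_mem_nhdsWithin.mono fun t ht => hb t ht)
    have e : ∀ n, (OneForm.pullback (QuotientGroup.mk A) (φ n N)).mass (matPreimage A B) =
        (φ n N).mass B := fun n => OneForm.mass_pullback A _ hB
    refine le_antisymm (key _ _ _ _ (fun n => hne n _ _) (fun n => hne n _ _)
      (hM (N + 1) (matPreimage A B)) (hM N B) fun t ht n => ?_) (key _ _ _ _ (fun n => hne n _ _)
      (fun n => hne n _ _) (hM N B) (hM (N + 1) (matPreimage A B)) fun t ht n => ?_)
    · have h := OneForm.mass_le_of_pos (Φ := φ n (N + 1))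
        (OneForm.aestronglyMeasurable_pullback (QuotientGroup.mk A) (hφ n N)) ht (matPreimage A B)
      rw [e] at h
      refine h.trans (le_of_eq ?_)
      simp only [hD, enorm_sub_rev]
    · rw [← e]
      exact OneForm.mass_le_of_pos (hφ n (N + 1)) ht (matPreimage A B)

/-! ### Convolution powers -/

section ConvolutionPowers

variable [MeasurableSpace PSL(2, ℂ)] [BorelSpace PSL(2, ℂ)]
  (μ : Measure PSL(2, ℂ)) [IsProbabilityMeasure μ]

theorem isProbabilityMeasure_convPow (n : ℕ) : IsProbabilityMeasure (convPow μ n) := by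
  induction n with
  | zero => exact inferInstanceAs (IsProbabilityMeasure (Measure.dirac 1))
  | succ n ih =>
    unfold convPow Measure.mconv
    exact Measure.isProbabilityMeasure_map measurable_mul.aemeasurable

theorem memL2_iterate_transfer {Φ : OneForm} (hΦ : Φ.MemL2) (N : ℕ) :
    ((OneForm.transfer μ)^[N] Φ).MemL2 := by
  induction N with
  | zero => exact hΦ
  | succ N ih =>
    rw [Function.iterate_succ_apply']
    exact OneForm.memL2_transfer μ ih

/-- The induction replaces Φ by its transfer, so the new operator is applied first and the almost
everywhere equality is never transferred. -/
theorem transfer_convPow_coeff (n : ℕ) {Φ : OneForm} (hΦ : Φ.MemL2) :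
    (Φ.transfer (convPow μ (n + 1))).coeff =ᵐ[volume] ((OneForm.transfer μ)^[n + 1] Φ).coeff := by
  induction n generalizing Φ with
  | zero =>
    have : convPow μ (0 + 1) = μ := Measure.mconv_dirac_one μ
    rw [this]
    rfl
  | succ n ih =>
    have := isProbabilityMeasure_convPow μ (n + 1)
    refine (OneForm.transfer_mconv_coeff (convPow μ (n + 1)) μ hΦ).trans ?_
    rw [Function.iterate_succ_apply]
    exact ih (OneForm.memL2_transfer μ hΦ)

theorem energy_iterate_le {Φ : OneForm} (hΦ : Φ.MemL2) {M N : ℕ} (hMN : M ≤ N) :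
    ((OneForm.transfer μ)^[N] Φ).energy ≤ ((OneForm.transfer μ)^[M] Φ).energy := by
  induction N, hMN using Nat.le_induction with
  | base => exact le_rfl
  | succ N _ ih =>
    rw [Function.iterate_succ_apply']
    exact (OneForm.energy_transfer_le μ (memL2_iterate_transfer μ hΦ N)).trans ih

/-- Rescale by the inverse square root of the energy, which is nonzero since the transfer, of no
larger energy, has positive energy. -/
theorem exists_energy_eq_one {ν : Measure PSL(2, ℂ)} [IsProbabilityMeasure ν] {ρ : ℝ≥0∞}
    {Φ : OneForm} (hΦ : Φ.MemL2) (h : ρ * Φ.energy < (Φ.transfer ν).energy) :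
    ∃ Ψ : OneForm, Ψ.MemL2 ∧ Ψ.energy = 1 ∧ ρ ≤ (Ψ.transfer ν).energy := by
  have hfin := (OneForm.memL2_iff.1 hΦ).2.ne
  have h0 : Φ.energy ≠ 0 := by
    intro h0
    have := h.trans_le (OneForm.energy_transfer_le ν hΦ)
    simp [h0] at this
  set e := Φ.energy.toReal with he
  have hepos : 0 < e := ENNReal.toReal_pos h0 hfin
  have hee : ENNReal.ofReal e = Φ.energy := ENNReal.ofReal_toReal hfin
  set c : ℂ := (((Real.sqrt e)⁻¹ : ℝ) : ℂ) with hc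
  have hcn : ‖c‖ₑ ^ 2 = ENNReal.ofReal e⁻¹ := by
    rw [← ofReal_norm, ← ENNReal.ofReal_pow (norm_nonneg _), hc, Complex.norm_real, norm_inv,
      Real.norm_of_nonneg (Real.sqrt_nonneg _), inv_pow, Real.sq_sqrt hepos.le]
  have hscale : ∀ Ψ Ψ' : OneForm, (Ψ'.coeff = (c • Ψ).coeff) →
      Ψ'.energy = ENNReal.ofReal e⁻¹ * Ψ.energy := by
    intro Ψ Ψ' hΨ
    unfold OneForm.energy
    rw [hΨ, ← hcn, ← lintegral_const_mul' _ _ (by finiteness)]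
    simp only [OneForm.coeff_smul, enorm_mul, mul_pow]
  refine ⟨c • Φ, l2FormSubmodule.smul_mem c hΦ, ?_, ?_⟩
  · rw [hscale Φ _ rfl, ← hee, ← ENNReal.ofReal_mul (by positivity), inv_mul_cancel₀ hepos.ne']
    simp
  · rw [hscale (Φ.transfer ν) _ (OneForm.transfer_smul_coeff ν c Φ)]
    calc ρ = ENNReal.ofReal e⁻¹ * (ρ * Φ.energy) := by
          rw [← hee, mul_comm ρ, ← mul_assoc, ← ENNReal.ofReal_mul (by positivity),
            inv_mul_cancel₀ hepos.ne']
          simp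
      _ ≤ _ := by gcongr

open Filter Topology in
/-- If all the operators `f_{μ^n}^*` nearly preserve the norm of some form, then the support of `μ`
is elementary. -/
theorem isElementary_support (Φ : ℕ → OneForm) (hΦ : ∀ n, (Φ n).MemL2)
    (h1 : ∀ n, (Φ n).energy = 1)
    (h : ∀ n, ENNReal.ofReal (1 - (1 / 2) ^ n) ≤ ((OneForm.transfer μ)^[n + 1] (Φ n)).energy) :
    IsElementary μ.support := by
  set φ : ℕ → ℕ → OneForm := fun n N => (OneForm.transfer μ)^[N] (Φ n) with hφdef
  have hφ : ∀ n N, (φ n N).MemL2 := fun n N => memL2_iterate_transfer μ (hΦ n) N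
  have hφm : ∀ n N, AEStronglyMeasurable (φ n N).coeff := fun n N => (OneForm.memL2_iff.1 (hφ n N)).1
  have hφ1 : ∀ n N, (φ n N).energy ≤ 1 := fun n N =>
    (energy_iterate_le μ (hΦ n) (Nat.zero_le N)).trans (h1 n).le
  have hφlow : ∀ n N, N ≤ n + 1 → ENNReal.ofReal (1 - (1 / 2) ^ n) ≤ (φ n N).energy :=
    fun n N hN => (h n).trans (energy_iterate_le μ (hΦ n) hN)
  set d : ℕ → ℕ → PSL(2, ℂ) → ℝ≥0∞ := fun n N g => ∫⁻ z,
    ‖(OneForm.pullback g (φ n N)).coeff z - (φ n (N + 1)).coeff z‖ₑ ^ 2 with hd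
  have hpow : ∀ n : ℕ, (0 : ℝ) ≤ 1 - (1 / 2) ^ n := fun n => by
    have : ((1 : ℝ) / 2) ^ n ≤ 1 := pow_le_one₀ (by norm_num) (by norm_num)
    linarith
  -- The mean defect is the energy lost between the iterates N and N + 1, whose energies both lie
  -- between 1 - 2^(-n) and 1.
  have hdint : ∀ n N, N ≤ n → ∫⁻ g, d n N g ∂μ ≤ ENNReal.ofReal ((1 / 2) ^ n) := by
    intro n N hN
    have e1 := OneForm.lintegral_defect_add_energy μ (hφ n N)
    have e2 : OneForm.transfer μ (φ n N) = φ n (N + 1) := by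
      simp only [hφdef, Function.iterate_succ_apply']
    rw [e2] at e1
    have e3 := hφlow n (N + 1) (by omega)
    have e4 : ∫⁻ g, d n N g ∂μ + ENNReal.ofReal (1 - (1 / 2) ^ n) ≤
        ENNReal.ofReal ((1 / 2) ^ n) + ENNReal.ofReal (1 - (1 / 2) ^ n) := by
      rw [← ENNReal.ofReal_add (by positivity) (hpow n)]
      calc _ ≤ ∫⁻ g, d n N g ∂μ + (φ n (N + 1)).energy := by gcongr
        _ = (φ n N).energy := e1
        _ ≤ 1 := hφ1 n N
        _ = _ := by simp
    exact (ENNReal.add_le_add_iff_right ENNReal.ofReal_ne_top).1 e4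
  set S : Set PSL(2, ℂ) := {g | ∀ N, Tendsto (fun n => d n N g) atTop (𝓝 0)} with hS
  have hSae : S ∈ ae μ := by
    change ∀ᵐ g ∂μ, ∀ N, Tendsto (fun n => d n N g) atTop (𝓝 0)
    rw [ae_all_iff]
    intro N
    have hmeas : ∀ n, AEMeasurable (d (n + N) N) μ := fun n =>
      (OneForm.aemeasurable_defect μ (hφm (n + N) N) (hφm (n + N) (N + 1))).lintegral_prod_right'
    -- Borel–Cantelli argument: a series of finite integral converges almost everywhere, so its
    -- terms tend to 0. The shift by N keeps to the range where `hdint` applies.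
    have hsum : ∫⁻ g, ∑' n, d (n + N) N g ∂μ ≠ ∞ := by
      rw [lintegral_tsum hmeas]
      refine ne_top_of_le_ne_top ?_ (ENNReal.tsum_le_tsum fun n => (hdint (n + N) N (by omega)).trans
        (ENNReal.ofReal_le_ofReal (pow_le_pow_of_le_one (by norm_num) (by norm_num)
          (Nat.le_add_right n N))))
      exact summable_geometric_two.tsum_ofReal_ne_top
    filter_upwards [ae_lt_top' (AEMeasurable.tsum hmeas) hsum] with g hg
    exact (tendsto_add_atTop_iff_nat N).1 (ENNReal.tendsto_atTop_zero_of_tsum_ne_top hg.ne)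
  have hel : IsElementary S := by
    refine isElementary_of_almost_invariant φ hφm hφ1 (fun N => ?_) fun g hg N => hg N
    refine tendsto_of_tendsto_of_tendsto_of_le_of_le' (g := fun n : ℕ =>
      ENNReal.ofReal (1 - (1 / 2) ^ n)) ?_ tendsto_const_nhds ?_
      (Eventually.of_forall fun n => hφ1 n N)
    · have h0 : Tendsto (fun n : ℕ => (1 : ℝ) - (1 / 2) ^ n) atTop (𝓝 (1 - 0)) :=
        tendsto_const_nhds.sub (tendsto_pow_atTop_nhds_zero_of_lt_one (by norm_num) (by norm_num))
      rw [sub_zero] at h0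
      have := (ENNReal.continuous_ofReal.tendsto _).comp h0
      rw [ENNReal.ofReal_one] at this
      exact this
    · filter_upwards [eventually_ge_atTop N] with n hn
      exact hφlow n N (by omega)
  refine hel.of_subset_closure (Measure.support_subset_of_isClosed isClosed_closure ?_)
  exact mem_of_superset hSae subset_closure

end ConvolutionPowers

end

/-! ### The proposition -/

theorem mainTheorem2 [MeasurableSpace PSL(2, ℂ)] [BorelSpace PSL(2, ℂ)]
    (μ : Measure PSL(2, ℂ)) [IsProbabilityMeasure μ] (hμ : ¬ IsElementary μ.support) :
    ∃ N : ℕ, 1 ≤ N ∧ ∃ T : L2Form →L[ℂ] L2Form,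
      IsTransferOperator (convPow μ N) T ∧ ‖T‖ < 1 := by
  by_contra hcon
  have hex : ∀ n : ℕ, ∃ Φ : OneForm, Φ.MemL2 ∧ Φ.energy = 1 ∧
      ENNReal.ofReal (1 - (1 / 2) ^ n) ≤ (Φ.transfer (convPow μ (n + 1))).energy := by
    intro n
    have := isProbabilityMeasure_convPow μ (n + 1)
    have hpow : ((1 : ℝ) / 2) ^ n ≤ 1 := pow_le_one₀ (by norm_num) (by norm_num)
    have hpos : (0 : ℝ) < (1 / 2) ^ n := by positivity
    -- Without such a form, the operator for the power n + 1 would have norm at most √(1 - 2^(-n)) <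
    -- 1. The rate 2^(-n) is chosen to be summable.
    obtain ⟨Φ, hΦ, hlt⟩ : ∃ Φ : OneForm, Φ.MemL2 ∧
        ENNReal.ofReal (1 - (1 / 2) ^ n) * Φ.energy < (Φ.transfer (convPow μ (n + 1))).energy := by
      by_contra! hno
      obtain ⟨T, hT, hTr⟩ := exists_isTransferOperator (convPow μ (n + 1))
        (Real.sqrt_nonneg (1 - (1 / 2) ^ n)) fun Φ hΦ => by
          rw [Real.sq_sqrt (by linarith)]
          exact hno Φ hΦ
      refine hcon ⟨n + 1, by omega, T, hT, hTr.trans_lt ?_⟩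
      rw [Real.sqrt_lt' one_pos]
      linarith
    exact exists_energy_eq_one hΦ hlt
  choose Φ hΦ h1 hlow using hex
  refine hμ (isElementary_support μ Φ hΦ h1 fun n => (hlow n).trans (le_of_eq ?_))
  refine lintegral_congr_ae ?_
  filter_upwards [transfer_convPow_coeff μ n (hΦ n)] with z hz
  rw [hz]
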